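/- **Setting.** Let $G=(\mathbb Z_2)^3$ and let $\Gamma$ be a finite connected regular $3$-valent graph (multiple edges are allowed) with edge set $E_\Gamma$. A *$G$-coloring* is a map $\alpha:E_\Gamma\to\mathrm{Hom}(G,\mathbb Z_2)$ such that at each vertex the colors of the three edges adjacent to it are linearly independent (so $\Gamma$ has no loops). It is *good* if for each edge $e_1$ with endpoints $v,w$ and each edge $e_0$ adjacent to $v$ there is one and only one edge $e_2$ adjacent to $w$ with $\mathrm{Span}(\alpha(e_0),\alpha(e_1))=\mathrm{Span}(\alpha(e_1),\alpha(e_2))$. For a subgraph $\Delta\subseteq\Gamma$ let $\dim_\alpha\Delta$ be the dimension of the span of the colors of its edges. A *$k$-nest* is a connected proper subgraph $\Delta\subsetneq\Gamma$ with $\dim_\alpha\Delta=k$ such that $\dim_\alpha\Delta'>k$ for every connected subgraph $\Delta'\supsetneq\Delta$ of $\Gamma$. A *$2$-skeletal expansion* of $(\Gamma,\alpha)$ is a topological space $M$ with a finite regular cell decomposition $K$ (the characteristic map of every cell is a homeomorphism from the closed ball onto the closed cell, and the boundary of every cell is a union of cells) together with a bijection $\kappa$ from $K$ to the set of all nests of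 dimension at most $2$ that preserves dimensions and face relations: $\overline\sigma\subseteq\overline\tau$ if and only if $\kappa(\sigma)\subseteq\kappa(\tau)$. **Theorem.** Suppose $G=(\mathbb Z_2)^3$, $\Gamma$ is a finite connected regular $3$-valent graph, and $\alpha:E_\Gamma\to\mathrm{Hom}(G,\mathbb Z_2)$ is a good coloring. Then $(\Gamma,\alpha)$ has a $2$-skeletal expansion $(M,K)$ in which $M$ is a closed surface, i.e. a compact connected $2$-manifold without boundary. Moreover, every $2$-nest is a circle (a finite connected $2$-valent graph); the boundary of every $2$-cell $\sigma$ is the union of the cells corresponding to the vertices and edges of the circle $\kappa(\sigma)$, that is, of the cells $\tau$ with $\kappa(\tau)\subsetneq\kappa(\sigma)$; and every edge of $\Gamma$ lies in $\kappa(\sigma)$ for exactly two $2$-cells $\sigma$. -/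

import Mathlib

open Set Metric
open scoped Graph

/-- The space of colors `Hom(G, ℤ₂)` for `G = (ℤ₂)ⁿ⁺¹`. (A group homomorphism `G → ℤ₂` is the same
thing as a `ℤ₂`-linear map.) -/
abbrev ColorSpace (n : ℕ) : Type := Module.Dual (ZMod 2) (Fin (n + 1) → ZMod 2)

namespace Graph

variable {V E : Type*}

/-- A (multi)graph is connected if it has a vertex and any two vertices are joined by a path of
edges. -/
def IsConn (Γ : Graph V E) : Prop :=
  V(Γ).Nonempty ∧ ∀ x ∈ V(Γ), ∀ y ∈ V(Γ), Relation.ReflTransGen Γ.Adj x y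

/-- The valence of a vertex: the number of edges at it, where a loop counts twice. -/
noncomputable def valence (Γ : Graph V E) (v : V) : ℕ∞ :=
  {e | Γ.Inc e v}.encard + {e | Γ.IsLoopAt e v}.encard

/-- Regular `d`-valent graphs. -/
def IsRegularOfValence (Γ : Graph V E) (d : ℕ) : Prop :=
  ∀ v ∈ V(Γ), Γ.valence v = d

/-- A circle: a finite connected `2`-valent graph. -/
def IsCircle (Δ : Graph V E) : Prop :=
  V(Δ).Finite ∧ E(Δ).Finite ∧ Δ.IsConn ∧ Δ.IsRegularOfValence 2

variable {n : ℕ}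

/-- `α` is a `G`-coloring: at each vertex the colors of the edges adjacent to it, listed with
multiplicity, are linearly independent. A loop would be listed twice, so there are no loops.
(Only the values of `α` on `E(Γ)` matter.) -/
def IsColoring (Γ : Graph V E) (α : E → ColorSpace n) : Prop :=
  ∀ v ∈ V(Γ), (∀ e, ¬ Γ.IsLoopAt e v) ∧ LinearIndepOn (ZMod 2) α {e | Γ.Inc e v}

/-- `α` is a "good" coloring: for each edge `e₁` with endpoints `v`, `w` and each edge `e₀` adjacent
to `v` there is one and only one edge `e₂` adjacent to `w` such that
`Span(α(e₀), α(e₁)) = Span(α(e₁), α(e₂))`. -/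
def IsGoodColoring (Γ : Graph V E) (α : E → ColorSpace n) : Prop :=
  Γ.IsColoring α ∧
    ∀ e₁ v w, Γ.IsLink e₁ v w → ∀ e₀, Γ.Inc e₀ v →
      ∃! e₂, Γ.Inc e₂ w ∧
        Submodule.span (ZMod 2) {α e₀, α e₁} = Submodule.span (ZMod 2) {α e₁, α e₂}

/-- The dimension of the span of the colors of the edges of a subgraph. -/
noncomputable def colorDim (α : E → ColorSpace n) (Δ : Graph V E) : ℕ :=
  Module.finrank (ZMod 2) (Submodule.span (ZMod 2) (α '' E(Δ)))

/-- `Δ` is a `k`-nest of `(Γ, α)`: a proper connected subgraph of color dimension `k` such that every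
strictly larger connected subgraph has color dimension `> k`. -/
def IsNest (Γ : Graph V E) (α : E → ColorSpace n) (k : ℕ) (Δ : Graph V E) : Prop :=
  Δ < Γ ∧ Δ.IsConn ∧ colorDim α Δ = k ∧
    ∀ Δ' : Graph V E, Δ' ≤ Γ → Δ'.IsConn → Δ < Δ' → k < colorDim α Δ'

/-- The `k`-skeleton `K_k(Γ, α)`: all nests of dimension at most `k`. Its face relation is the
subgraph relation. -/
def NestSkeleton (Γ : Graph V E) (α : E → ColorSpace n) (k : ℕ) : Type _ :=
  {Δ : Graph V E // ∃ d ≤ k, Γ.IsNest α d Δ}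

end Graph

open Topology in
/-- A cell decomposition of `M` is regular if every characteristic map restricts to a homeomorphism
of the closed ball onto its image (the closed cell, with the sphere going to the boundary of the
cell), and if the boundary of every cell is a union of (open) cells. -/
def IsRegularCellDecomposition (M : Type*) [TopologicalSpace M] [CWComplex (univ : Set M)] : Prop :=
  ∀ (d : ℕ) (c : RelCWComplex.cell (univ : Set M) d),
    IsEmbedding ((closedBall (0 : Fin d → ℝ) 1).domRestrict (RelCWComplex.map d c)) ∧
    ∃ S : Set (Σ m, RelCWComplex.cell (univ : Set M) m),
      RelCWComplex.cellFrontier d c = ⋃ s ∈ S, RelCWComplex.openCell s.1 s.2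

open Topology in
/-- A `k`-skeletal expansion of `(Γ, α)` on the space `M`: a finite regular cell decomposition of `M`
together with a one-to-one correspondence between its cells and the nests of dimension at most `k`
that preserves dimensions and face relations. -/
structure SkeletalExpansion {V E : Type*} {n : ℕ} (Γ : Graph V E) (α : E → ColorSpace n) (k : ℕ)
    (M : Type*) [TopologicalSpace M] where
  /-- `M` is Hausdorff (as always for cell complexes). -/
  t2 : T2Space M
  /-- The cell decomposition. -/
  cw : CWComplex (univ : Set M)
  finite : RelCWComplex.Finite (univ : Set M)
  regular : IsRegularCellDecomposition M
  /-- The correspondence between cells and nests. -/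
  nest : (Σ d, RelCWComplex.cell (univ : Set M) d) ≃ Γ.NestSkeleton α k
  isNest_nest : ∀ (d : ℕ) (c : RelCWComplex.cell (univ : Set M) d), Γ.IsNest α d (nest ⟨d, c⟩).1
  face_iff : ∀ s t : (Σ d, RelCWComplex.cell (univ : Set M) d),
    RelCWComplex.closedCell s.1 s.2 ⊆ RelCWComplex.closedCell t.1 t.2 ↔ (nest s).1 ≤ (nest t).1

namespace SkeletalExpansion

open Topology

variable {V E : Type*} {n : ℕ} {Γ : Graph V E} {α : E → ColorSpace n} {k : ℕ}
  {M : Type*} [TopologicalSpace M]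

/-- The `d`-cells. -/
def Cell (K : SkeletalExpansion Γ α k M) (d : ℕ) : Type _ :=
  K.cw.cell d

/-- The nest of a `d`-cell, as a subgraph of `Γ`. -/
def nestOf (K : SkeletalExpansion Γ α k M) {d : ℕ} (c : K.Cell d) : Graph V E :=
  (K.nest ⟨d, c⟩).1

/-- The open cell, as a subset of `M`. -/
def openCell (K : SkeletalExpansion Γ α k M) {d : ℕ} (c : K.Cell d) : Set M :=
  K.cw.map d c '' ball 0 1

/-- The boundary sphere of a cell, as a subset of `M`. -/
def boundary (K : SkeletalExpansion Γ α k M) {d : ℕ} (c : K.Cell d) : Set M :=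
  K.cw.map d c '' sphere 0 1

end SkeletalExpansion

/-- A closed surface: a compact connected Hausdorff second countable space that is locally
homeomorphic to the plane (in particular, without boundary). -/
def IsClosedSurface (M : Type*) [TopologicalSpace M] : Prop :=
  CompactSpace M ∧ ConnectedSpace M ∧ T2Space M ∧ SecondCountableTopology M ∧
    Nonempty (ChartedSpace (EuclideanSpace ℝ (Fin 2)) M)

/-!
The surface is the order complex of the poset of nests of dimension at most `2`, that is, the
barycentric subdivision of the cell complex to be constructed. It is realized in barycentric
coordinates as a compact subset of `ℝ^P`, where `P` is that poset, so that no quotient or gluing is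
needed.

Combinatorially, a nest is a component of the subgraph of all edges whose color lies in the span of
the colors of the nest (`Graph.IsNest.eq_colorComponent`), and any one or two edges at a vertex
span a nest (`Graph.IsColoring.isNest_colorComponent`). Hence nests of dimensions `0` and `1` are
the vertices and the edges. Goodness transports a corner along each of its edges
(`Graph.IsGoodColoring.exists_corner_of_mem`), so a nest of dimension `2` has exactly two edges at
each of its vertices: it is a circle, determined by any of its corners. Therefore the link of a
vertex in `P` is a hexagon (three edges alternating with three corners), the link of an edge is a
square (two ends alternating with two faces), and the elements below a face form a cycle of
alternating vertices and edges; the cyclic order in the last case comes from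
`exists_cyclic_enumeration`.

Topologically, everything rests on one fact (`exists_cone_cycle`): the cone over a cycle of length
at least four is homeomorphic to the plane, in such a way that the height in the cone is the sup
norm. It is proved by induction: the square is handled by positive and negative parts of two
coordinates, and subdividing one edge of the cycle does not change the cone. In the order complex
the coordinate at `s` is one minus the height in the cone over the other coordinates, so a point
joined with a cycle of comparable elements is a disc
(`OrderComplex.exists_ball_parametrization`). Applied to the elements below `s`, and to the easier
cones over the empty set and over two points, this gives the characteristic maps of the cells;
applied to the whole link of `s`, it gives a chart on the open star of `s`.
-/

open Set Metric
open scoped Graph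

/-! ### Cones over cycles -/

/-- The open cone on the clique complex of the relation `R` on the vertex set `L`: nonnegative
weights that vanish off `L` and whose support consists of pairwise related points. The apex is the
zero function, and the sum of the weights is the height. -/
def cliqueCone {P : Type*} (R : P → P → Prop) (L : Set P) : Set (P → ℝ) :=
  {y | (∀ p, 0 ≤ y p) ∧ (∀ p, p ∉ L → y p = 0) ∧
    ∀ p q, y p ≠ 0 → y q ≠ 0 → p = q ∨ R p q}

/-- Adjacency in the cycle `0, 1, …, m - 1`. -/
def CycAdj (m i j : ℕ) : Prop :=
  i + 1 = j ∨ j + 1 = i ∨ (i = 0 ∧ j + 1 = m) ∨ (j = 0 ∧ i + 1 = m)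

lemma norm_fin_two (z : Fin 2 → ℝ) : ‖z‖ = max |z 0| |z 1| := by
  simp [Pi.norm_def, Fin.univ_succ, Real.norm_eq_abs]

/-- The cone on a square is the plane: the four weights are the positive and negative parts of two
coordinates, turned by `45°` so that their sum becomes the sup norm. -/
lemma exists_cone_square :
    ∃ Φ : (Fin 2 → ℝ) → ℕ → ℝ, Continuous Φ ∧ Function.Injective Φ ∧
      range Φ = cliqueCone (CycAdj 4) (Iio 4) ∧ ∀ z, ∑ i ∈ Finset.range 4, Φ z i = ‖z‖ := by
  refine ⟨fun z i => if i = 0 then max ((z 0 + z 1) / 2) 0 else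
    if i = 1 then max ((z 0 - z 1) / 2) 0 else if i = 2 then max (-((z 0 + z 1) / 2)) 0 else
    if i = 3 then max (-((z 0 - z 1) / 2)) 0 else 0, ?_, ?_, ?_, ?_⟩
  · refine continuous_pi fun i => ?_
    split_ifs <;> fun_prop
  · intro z w h
    have h0 := congrFun h 0
    have h1 := congrFun h 1
    have h2 := congrFun h 2
    have h3 := congrFun h 3
    simp only [if_true, one_ne_zero, if_false, OfNat.ofNat_ne_zero, OfNat.ofNat_ne_one] at h0 h1 h2 h3
    norm_num at h1 h2 h3
    have e1 : (z 0 + z 1) / 2 = (w 0 + w 1) / 2 := by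
      grind
    have e2 : (z 0 - z 1) / 2 = (w 0 - w 1) / 2 := by
      grind
    funext i
    fin_cases i <;> simp <;> linarith
  · ext y
    constructor
    · rintro ⟨z, rfl⟩
      refine ⟨fun p => ?_, fun p hp => ?_, fun p q hp hq => ?_⟩
      · dsimp only
        split_ifs <;> simp
      · simp only [mem_Iio] at hp
        grind
      · simp only [CycAdj]
        grind
    · rintro ⟨h0, hL, hR⟩
      have h02 : y 0 = 0 ∨ y 2 = 0 := by
        by_contra! h
        have := hR 0 2 h.1 h.2
        simp [CycAdj] at this
      have h13 : y 1 = 0 ∨ y 3 = 0 := by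
        by_contra! h
        have := hR 1 3 h.1 h.2
        simp [CycAdj] at this
      have p0 := h0 0
      have p1 := h0 1
      have p2 := h0 2
      have p3 := h0 3
      refine ⟨![y 0 - y 2 + (y 1 - y 3), y 0 - y 2 - (y 1 - y 3)], ?_⟩
      funext i
      have h4 : 4 ≤ i → y i = 0 := fun h => hL i (by simpa using h)
      simp only [Matrix.cons_val_zero, Matrix.cons_val_one]
      grind
  · intro z
    rw [norm_fin_two]
    simp only [Finset.sum_range_succ, Finset.range_zero, Finset.sum_empty]
    norm_num
    grind

/-- The cone on the `m`-cycle maps to the cone on the `(m + 1)`-cycle by subdividing the edge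
between `m - 1` and `0`: the new vertex `m` is the midpoint of that edge. -/
noncomputable def subdivideCone (m : ℕ) (y : ℕ → ℝ) (i : ℕ) : ℝ :=
  if i = m then 2 * min (y 0) (y (m - 1))
  else if i = 0 ∨ i = m - 1 then y i - min (y 0) (y (m - 1)) else y i

/-- The cone on a cycle is the plane, and the height in the cone is the sup norm. -/
lemma exists_cone_cycle (m : ℕ) (hm : 4 ≤ m) :
    ∃ Φ : (Fin 2 → ℝ) → ℕ → ℝ, Continuous Φ ∧ Function.Injective Φ ∧
      range Φ = cliqueCone (CycAdj m) (Iio m) ∧ ∀ z, ∑ i ∈ Finset.range m, Φ z i = ‖z‖ := by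
  induction m, hm using Nat.le_induction with
  | base => exact exists_cone_square
  | succ m hm ih =>
    obtain ⟨Φ, hc, hi, hr, hs⟩ := ih
    have hΦ : ∀ z, Φ z ∈ cliqueCone (CycAdj m) (Iio m) := fun z => hr ▸ mem_range_self z
    refine ⟨fun z => subdivideCone m (Φ z), ?_, ?_, ?_, ?_⟩
    · have hc' : ∀ i, Continuous fun z => Φ z i := fun i => (continuous_apply i).comp hc
      refine continuous_pi fun i => ?_
      have h1 := hc' i
      have h2 := hc' 0
      have h3 := hc' (m - 1)
      unfold subdivideCone
      split_ifs <;> fun_prop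
    · intro z w h
      apply hi
      have hz : Φ z m = 0 := (hΦ z).2.1 m (by simp)
      have hw : Φ w m = 0 := (hΦ w).2.1 m (by simp)
      have hm' := congrFun h m
      simp only [subdivideCone, if_true] at hm'
      funext i
      have h' := congrFun h i
      simp only [subdivideCone] at h'
      grind
    · ext y
      constructor
      · rintro ⟨z, rfl⟩
        obtain ⟨h0, hL, hR⟩ := hΦ z
        refine ⟨fun p => ?_, fun p hp => ?_, fun p q hp hq => ?_⟩
        · have := h0 p
          have := h0 0
          have := h0 (m - 1)
          simp only [subdivideCone]
          grind
        · have := hL p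
          simp only [mem_Iio] at *
          simp only [subdivideCone]
          grind
        · simp only [subdivideCone] at hp hq
          have a0 := h0 0
          have a1 := h0 (m - 1)
          have lp := hL p
          have lq := hL q
          have := hR p q
          have := hR 0 p
          have := hR (m - 1) p
          have := hR 0 q
          have := hR (m - 1) q
          simp only [CycAdj, mem_Iio] at *
          grind
      · rintro ⟨h0, hL, hR⟩
        have hadj : y 0 = 0 ∨ y (m - 1) = 0 := by
          by_contra! h
          have := hR 0 (m - 1) h.1 h.2
          simp only [CycAdj] at this
          omega
        have hmem : (fun i => if i = m then 0 else if i = 0 ∨ i = m - 1 then y i + y m / 2 else y i)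
            ∈ cliqueCone (CycAdj m) (Iio m) := by
          refine ⟨fun p => ?_, fun p hp => ?_, fun p q hp hq => ?_⟩
          · have := h0 p
            have := h0 m
            dsimp only
            split_ifs <;> linarith
          · have := hL p
            simp only [mem_Iio] at *
            grind
          · have lp := hL p
            have lq := hL q
            have := hR p q
            have := hR p m
            have := hR q m
            simp only [CycAdj, mem_Iio] at *
            grind
        rw [← hr] at hmem
        obtain ⟨z, hz⟩ := hmem
        refine ⟨z, ?_⟩
        funext i
        have h0 := h0 m
        simp only [subdivideCone, hz]
        grind
    · intro z
      obtain ⟨h0, hL, hR⟩ := hΦ z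
      rw [← hs z]
      obtain ⟨k, rfl⟩ : ∃ k, m = k + 2 := ⟨m - 2, by omega⟩
      have e1 : ∑ i ∈ Finset.range k, subdivideCone (k + 2) (Φ z) (i + 1) =
          ∑ i ∈ Finset.range k, Φ z (i + 1) := by
        refine Finset.sum_congr rfl fun i hi => ?_
        rw [Finset.mem_range] at hi
        simp only [subdivideCone]
        grind
      rw [Finset.sum_range_succ, Finset.sum_range_succ, Finset.sum_range_succ',
        Finset.sum_range_succ, Finset.sum_range_succ', e1]
      simp [subdivideCone]
      ring

/-! ### Relations whose clique complex is a sphere -/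

/-- The cone on the clique complex of `R` on `L` is a copy of `ℝᵈ` in which the height is the sup
norm; in particular that clique complex is a `(d - 1)`-sphere. -/
def IsEuclideanCone {P : Type*} [Fintype P] (d : ℕ) (R : P → P → Prop) (L : Set P) : Prop :=
  ∃ Φ : (Fin d → ℝ) → P → ℝ, Continuous Φ ∧ Function.Injective Φ ∧
    range Φ = cliqueCone R L ∧ ∀ z, ∑ p, Φ z p = ‖z‖

section cones

variable {P : Type*} [Fintype P] {R : P → P → Prop}

lemma isEuclideanCone_zero : IsEuclideanCone 0 R ∅ := by
  refine ⟨fun _ _ => 0, continuous_const, fun z w _ => Subsingleton.elim z w, ?_, fun z => ?_⟩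
  · ext y
    constructor
    · rintro ⟨z, rfl⟩
      exact ⟨fun p => le_rfl, fun p _ => rfl, fun p q h => absurd rfl h⟩
    · rintro ⟨-, h, -⟩
      exact ⟨0, funext fun p => (h p (notMem_empty p)).symm⟩
  · rw [Subsingleton.elim z 0, norm_zero, Finset.sum_const_zero]

lemma isEuclideanCone_one {v w : P} (hvw : v ≠ w) (h : ¬ R v w) :
    IsEuclideanCone 1 R {v, w} := by
  classical
  refine ⟨fun z p => if p = v then max (z 0) 0 else if p = w then max (-z 0) 0 else 0,
    ?_, ?_, ?_, ?_⟩
  · refine continuous_pi fun i => ?_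
    split_ifs <;> fun_prop
  · intro z z' h
    have hv := congrFun h v
    have hw := congrFun h w
    funext i
    fin_cases i
    grind
  · ext y
    constructor
    · rintro ⟨z, rfl⟩
      refine ⟨fun p => ?_, fun p hp => ?_, fun p q hp hq => ?_⟩
      · dsimp only
        split_ifs <;> simp
      · grind
      · grind
    · rintro ⟨h0, hL, hR⟩
      have hvw' := hR v w
      have hv := h0 v
      have hw := h0 w
      refine ⟨fun _ => y v - y w, ?_⟩
      funext p
      have := hL p
      grind
  · intro z
    have e : ∀ p, (if p = v then max (z 0) 0 else if p = w then max (-z 0) 0 else 0) =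
        (if p = v then max (z 0) 0 else 0) + if p = w then max (-z 0) 0 else 0 := by grind
    have e' : ‖z‖ = |z 0| := by simp [Pi.norm_def, Real.norm_eq_abs]
    simp only [e, Finset.sum_add_distrib, Finset.sum_ite_eq', Finset.mem_univ, if_true, e']
    grind

/-- A set whose relation is that of a cycle of length at least `4` has a planar cone. (A triangle
would be filled in by its clique complex.) -/
lemma isEuclideanCone_two {L : Set P} {m : ℕ} (hm : 4 ≤ m) {a : ℕ → P} (ha : BijOn a (Iio m) L)
    (hR : ∀ i < m, ∀ j < m, i ≠ j → (R (a i) (a j) ↔ CycAdj m i j)) :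
    IsEuclideanCone 2 R L := by
  classical
  obtain ⟨Φ, hc, hi, hr, hs⟩ := exists_cone_cycle m hm
  have hΦ : ∀ z, Φ z ∈ cliqueCone (CycAdj m) (Iio m) := fun z => hr ▸ mem_range_self z
  obtain ⟨b, hbi, hb⟩ : ∃ b : P → ℕ, (∀ i < m, b (a i) = i) ∧ ∀ p ∈ L, b p < m ∧ a (b p) = p :=
    ⟨Function.invFunOn a (Iio m), fun i hi => ha.invOn_invFunOn.1 hi,
      fun p hp => ⟨ha.surjOn.mapsTo_invFunOn hp, ha.invOn_invFunOn.2 hp⟩⟩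
  have haL : ∀ i < m, a i ∈ L := fun i hi => ha.mapsTo hi
  refine ⟨fun z p => if p ∈ L then Φ z (b p) else 0, ?_, ?_, ?_, ?_⟩
  · refine continuous_pi fun p => ?_
    have := (continuous_apply (b p)).comp hc
    split_ifs
    · exact this
    · exact continuous_const
  · intro z w h
    apply hi
    funext i
    by_cases him : i < m
    · have := congrFun h (a i)
      simpa [haL i him, hbi i him] using this
    · rw [(hΦ z).2.1 i him, (hΦ w).2.1 i him]
  · ext y
    constructor
    · rintro ⟨z, rfl⟩
      obtain ⟨h0, hL, hR'⟩ := hΦ z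
      refine ⟨fun p => ?_, fun p hp => if_neg hp, fun p q hp hq => ?_⟩
      · dsimp only
        split_ifs
        · exact h0 _
        · exact le_rfl
      · simp only [ne_eq, ite_eq_right_iff, Classical.not_imp] at hp hq
        obtain ⟨bp, abp⟩ := hb p hp.1
        obtain ⟨bq, abq⟩ := hb q hq.1
        by_cases hpq : b p = b q
        · exact Or.inl (abp ▸ abq ▸ congrArg a hpq)
        · have h1 := (hR' _ _ hp.2 hq.2).resolve_left hpq
          rw [← hR _ bp _ bq hpq, abp, abq] at h1
          exact Or.inr h1
    · rintro ⟨h0, hL, hR'⟩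
      have hmem : (fun i => if i < m then y (a i) else 0) ∈ cliqueCone (CycAdj m) (Iio m) := by
        refine ⟨fun i => ?_, fun i hi => if_neg hi, fun i j hi hj => ?_⟩
        · dsimp only
          split_ifs
          · exact h0 _
          · exact le_rfl
        · simp only [ne_eq, ite_eq_right_iff, Classical.not_imp] at hi hj
          by_cases hij : i = j
          · exact Or.inl hij
          · rw [← hR i hi.1 j hj.1 hij]
            exact Or.inr ((hR' _ _ hi.2 hj.2).resolve_left
              fun e => hij (ha.injOn hi.1 hj.1 e))
      rw [← hr] at hmem
      obtain ⟨z, hz⟩ := hmem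
      refine ⟨z, funext fun p => ?_⟩
      by_cases hp : p ∈ L
      · simp [hp, hz, hb p hp]
      · simp [hp, hL p hp]
  · intro z
    rw [← hs z, ← Finset.sum_filter]
    refine Finset.sum_nbij' b a ?_ ?_ ?_ ?_ ?_
    · intro p hp
      simpa using (hb p (by simpa using hp)).1
    · intro i hi
      simpa using haL i (by simpa using hi)
    · intro p hp
      exact (hb p (by simpa using hp)).2
    · intro i hi
      exact hbi i (by simpa using hi)
    · intro p _
      rfl

end cones

/-! ### The order complex of a finite poset -/

/-- Comparability in a preorder. -/
def Comparable {P : Type*} [LE P] (p q : P) : Prop := p ≤ q ∨ q ≤ p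

lemma comparable_comm {P : Type*} [LE P] {p q : P} : Comparable p q ↔ Comparable q p :=
  or_comm

/-- The geometric realization of the order complex of a finite poset, in barycentric coordinates. -/
abbrev OrderComplex (P : Type*) [Fintype P] [PartialOrder P] : Type _ :=
  {x : P → ℝ // (∀ p, 0 ≤ x p) ∧ ∑ p, x p = 1 ∧ ∀ p q, x p ≠ 0 → x q ≠ 0 → Comparable p q}

namespace OrderComplex

variable {P : Type*} [Fintype P] [PartialOrder P]

lemma continuous_coord (p : P) : Continuous fun x : OrderComplex P => x.1 p :=
  (continuous_apply p).comp continuous_subtype_val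

instance : CompactSpace (OrderComplex P) := by
  refine isCompact_iff_compactSpace.mp (?_ : IsCompact {x : P → ℝ | (∀ p, 0 ≤ x p) ∧
    ∑ p, x p = 1 ∧ ∀ p q, x p ≠ 0 → x q ≠ 0 → Comparable p q})
  refine IsCompact.of_isClosed_subset (isCompact_univ_pi fun _ : P => isCompact_Icc (a := (0 : ℝ))
    (b := 1)) ?_ ?_
  · have e : {x : P → ℝ | (∀ p, 0 ≤ x p) ∧ ∑ p, x p = 1 ∧
        ∀ p q, x p ≠ 0 → x q ≠ 0 → Comparable p q} =
        (⋂ p, {x | 0 ≤ x p}) ∩ {x | ∑ p, x p = 1} ∩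
          ⋂ (p) (q) (_ : ¬ Comparable p q), {x | x p * x q = 0} := by
      ext x
      simp only [mem_ofPred_eq, mem_inter_iff, mem_iInter, and_assoc, mul_eq_zero]
      refine and_congr_right fun _ => and_congr_right fun _ => forall₂_congr fun p q => ?_
      grind
    rw [e]
    refine IsClosed.inter (IsClosed.inter ?_ ?_) ?_
    · exact isClosed_iInter fun p => isClosed_le continuous_const (continuous_apply p)
    · exact isClosed_eq (by fun_prop) continuous_const
    · exact isClosed_iInter fun p => isClosed_iInter fun q => isClosed_iInter fun _ =>
        isClosed_eq (by fun_prop) continuous_const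
  · rintro x ⟨h0, h1, -⟩ p -
    exact ⟨h0 p, h1 ▸ Finset.single_le_sum (fun q _ => h0 q) (Finset.mem_univ p)⟩

/-- The vertex of the order complex at an element of the poset. -/
noncomputable def vertex (s : P) : OrderComplex P := by
  classical
  exact ⟨Pi.single s 1, fun p => by by_cases h : p = s <;> simp [h], by simp,
    fun p q hp hq => by
      simp only [Pi.single_apply, ne_eq, ite_eq_right_iff, one_ne_zero, imp_false,
        not_not] at hp hq
      exact Or.inl (by rw [hp, hq])⟩

lemma vertex_self (s : P) : (vertex s).1 s = 1 := by simp [vertex]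

lemma vertex_of_ne {s p : P} (h : p ≠ s) : (vertex s).1 p = 0 := by simp [vertex, h]

/-- The join of the point `s` with the order complex of a set `L` of elements comparable to `s` is
a ball with centre `s`, whenever the cone on `L` is Euclidean: the coordinates off `s` are those of
the cone and the coordinate at `s` is one minus the height. -/
lemma exists_ball_parametrization {d : ℕ} {s : P} {L : Set P}
    (hL : IsEuclideanCone d Comparable L) (hsL : s ∉ L) (hcomp : ∀ p ∈ L, Comparable s p) :
    ∃ f : (Fin d → ℝ) → OrderComplex P, ContinuousOn f (closedBall 0 1) ∧
      InjOn f (closedBall 0 1) ∧ (∀ z ∈ closedBall 0 1, (f z).1 s = 1 - ‖z‖) ∧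
      f '' closedBall 0 1 = {x | ∀ p, p ≠ s → p ∉ L → x.1 p = 0} := by
  classical
  obtain ⟨Φ, hc, hi, hr, hs⟩ := hL
  have hΦ : ∀ z, Φ z ∈ cliqueCone Comparable L := fun z => hr ▸ mem_range_self z
  have hΦs : ∀ z, Φ z s = 0 := fun z => (hΦ z).2.1 s hsL
  have hmem : ∀ z : Fin d → ℝ, ‖z‖ ≤ 1 → (∀ p, 0 ≤ Function.update (Φ z) s (1 - ‖z‖) p) ∧
      ∑ p, Function.update (Φ z) s (1 - ‖z‖) p = 1 ∧
      ∀ p q, Function.update (Φ z) s (1 - ‖z‖) p ≠ 0 →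
        Function.update (Φ z) s (1 - ‖z‖) q ≠ 0 → Comparable p q := by
    intro z hz
    obtain ⟨h0, hL, hR⟩ := hΦ z
    refine ⟨fun p => ?_, ?_, fun p q hp hq => ?_⟩
    · rw [Function.update_apply]
      split_ifs
      · linarith
      · exact h0 p
    · have := hs z
      rw [← Finset.add_sum_erase _ _ (Finset.mem_univ s), hΦs, zero_add] at this
      rw [← Finset.add_sum_erase _ _ (Finset.mem_univ s), Function.update_self,
        Finset.sum_congr rfl fun p hp => Function.update_of_ne (Finset.ne_of_mem_erase hp) _ _,
        this]
      ring
    · rw [Function.update_apply] at hp hq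
      have hpL := hL p
      have hqL := hL q
      have hp' := hcomp p
      have hq' := hcomp q
      have := hR p q
      unfold Comparable at *
      by_cases h1 : p = s <;> by_cases h2 : q = s
      · exact Or.inl (by rw [h1, h2])
      · subst h1
        simp only [h2, if_false] at hq
        tauto
      · subst h2
        simp only [h1, if_false] at hp
        tauto
      · simp only [h1, h2, if_false] at hp hq
        rcases this hp hq with h | h
        · exact Or.inl h.le
        · exact h
  obtain ⟨f, hf⟩ : ∃ f : (Fin d → ℝ) → OrderComplex P, ∀ z ∈ closedBall (0 : Fin d → ℝ) 1,
      (f z).1 = Function.update (Φ z) s (1 - ‖z‖) := by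
    refine ⟨fun z => if h : ‖z‖ ≤ 1 then ⟨_, hmem z h⟩ else vertex s, fun z hz => ?_⟩
    exact congrArg Subtype.val (dif_pos (mem_closedBall_zero_iff.mp hz))
  refine ⟨f, ?_, ?_, fun z hz => by rw [hf z hz, Function.update_self], ?_⟩
  · refine Topology.IsInducing.subtypeVal.continuousOn_iff.mpr ?_
    exact ContinuousOn.congr (hc.update s (by fun_prop)).continuousOn hf
  · intro z hz w hw h
    apply hi
    have h' := (hf z hz).symm.trans ((congrArg Subtype.val h).trans (hf w hw))
    funext p
    by_cases hp : p = s
    · rw [hp, hΦs, hΦs]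
    · simpa [hp] using congrFun h' p
  · ext x
    constructor
    · rintro ⟨z, hz, rfl⟩ p hp hpL
      rw [hf z hz, Function.update_of_ne hp, (hΦ z).2.1 p hpL]
    · intro hx
      obtain ⟨x0, x1, xR⟩ := x.2
      have hm : Function.update x.1 s 0 ∈ cliqueCone Comparable L := by
        refine ⟨fun p => ?_, fun p hp => ?_, fun p q hp hq => Or.inr (xR p q ?_ ?_)⟩
        · rw [Function.update_apply]
          split_ifs
          · exact le_rfl
          · exact x0 p
        · rw [Function.update_apply]
          split_ifs with h
          · rfl
          · exact hx p h hp
        · rw [Function.update_apply] at hp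
          grind
        · rw [Function.update_apply] at hq
          grind
      rw [← hr] at hm
      obtain ⟨z, hz⟩ := hm
      have hzn : 1 - ‖z‖ = x.1 s := by
        rw [← hs, hz]
        rw [← Finset.add_sum_erase _ _ (Finset.mem_univ s)] at x1 ⊢
        rw [Function.update_self, Finset.sum_congr rfl fun p hp =>
          Function.update_of_ne (Finset.ne_of_mem_erase hp) _ _]
        linarith
      have hz1 : z ∈ closedBall 0 1 := by
        have := x0 s
        rw [mem_closedBall_zero_iff]
        linarith
      refine ⟨z, hz1, Subtype.ext ?_⟩
      rw [hf z hz1, hzn, hz, Function.update_idem, Function.update_eq_self]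

end OrderComplex

/-- The inverse of a continuous injection of a compact set is continuous. -/
lemma ContinuousOn.continuousOn_of_leftInvOn {X Y : Type*} [TopologicalSpace X]
    [TopologicalSpace Y] [T2Space Y] {f : X → Y} {g : Y → X} {K B : Set X} (hK : IsCompact K)
    (hf : ContinuousOn f K) (hinj : InjOn f K) (hB : B ⊆ K) (hg : LeftInvOn g f B) :
    ContinuousOn g (f '' B) := by
  rw [continuousOn_iff_isClosed]
  intro t ht
  refine ⟨f '' (K ∩ t), ((hK.inter_right ht).image_of_continuousOn
    (hf.mono inter_subset_left)).isClosed, ?_⟩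
  ext y
  constructor
  · rintro ⟨hy, x, hx, rfl⟩
    rw [mem_preimage, hg hx] at hy
    exact ⟨⟨x, ⟨hB hx, hy⟩, rfl⟩, x, hx, rfl⟩
  · rintro ⟨⟨x, ⟨hxK, hxt⟩, rfl⟩, x', hx', e⟩
    have := hinj (hB hx') hxK e
    subst this
    exact ⟨by rwa [mem_preimage, hg hx'], x', hx', rfl⟩

/-! ### The cell decomposition of the order complex -/

/-- A ranked finite poset in which every element spans a cell of dimension its rank and has a
circle as its link: the combinatorial form of a cellular closed surface. -/
structure IsSurfacePoset {P : Type*} [Fintype P] [PartialOrder P] (r : P → ℕ) : Prop where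
  nonempty : Nonempty P
  strictMono : StrictMono r
  cone_Iio : ∀ s, IsEuclideanCone (r s) Comparable (Iio s)
  cone_link : ∀ s : P, IsEuclideanCone 2 Comparable {p | p ≠ s ∧ Comparable s p}
  connected : ∀ s t : P, Relation.ReflTransGen Comparable s t

namespace OrderComplex

section parametrization

variable {P : Type*} [Fintype P] [PartialOrder P] {d : ℕ} {s : P} {S : Set (OrderComplex P)}
  {f : (Fin d → ℝ) → OrderComplex P}

lemma image_ball_eq (hs : ∀ z ∈ closedBall 0 1, (f z).1 s = 1 - ‖z‖)
    (hS : f '' closedBall 0 1 = S) : f '' ball 0 1 = {x ∈ S | x.1 s ≠ 0} := by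
  subst hS
  ext x
  constructor
  · rintro ⟨z, hz, rfl⟩
    refine ⟨mem_image_of_mem f (ball_subset_closedBall hz), ?_⟩
    rw [hs z (ball_subset_closedBall hz)]
    rw [mem_ball_zero_iff] at hz
    linarith
  · rintro ⟨⟨z, hz, rfl⟩, hx⟩
    rw [hs z hz] at hx
    rw [mem_closedBall_zero_iff] at hz
    refine ⟨z, ?_, rfl⟩
    rw [mem_ball_zero_iff]
    exact lt_of_le_of_ne hz fun h => hx (by rw [h, sub_self])

lemma image_sphere_eq (hs : ∀ z ∈ closedBall 0 1, (f z).1 s = 1 - ‖z‖)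
    (hS : f '' closedBall 0 1 = S) : f '' sphere 0 1 = {x ∈ S | x.1 s = 0} := by
  subst hS
  ext x
  constructor
  · rintro ⟨z, hz, rfl⟩
    refine ⟨mem_image_of_mem f (sphere_subset_closedBall hz), ?_⟩
    rw [hs z (sphere_subset_closedBall hz), mem_sphere_zero_iff_norm.mp hz, sub_self]
  · rintro ⟨⟨z, hz, rfl⟩, hx⟩
    rw [hs z hz] at hx
    refine ⟨z, ?_, rfl⟩
    rw [mem_sphere_zero_iff_norm]
    linarith

end parametrization

variable {P : Type} [Fintype P] [PartialOrder P] {r : P → ℕ}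

/-- The support of a point, being a finite chain, has a largest element: the cell that carries the
point. -/
lemma exists_carrier (x : OrderComplex P) : ∃ s, x.1 s ≠ 0 ∧ ∀ p, ¬ p ≤ s → x.1 p = 0 := by
  obtain ⟨x, h0, h1, hR⟩ := x
  have hne : {p | x p ≠ 0}.Nonempty := by
    by_contra h
    rw [not_nonempty_iff_eq_empty, eq_empty_iff_forall_notMem] at h
    have : ∀ p, x p = 0 := fun p => not_not.mp (h p)
    simp [this] at h1
  obtain ⟨s, hs⟩ := (toFinite {p | x p ≠ 0}).exists_maximal hne
  refine ⟨s, hs.1, fun p hp => ?_⟩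
  by_contra hxp
  rcases hR p s hxp hs.1 with h | h
  · exact hp h
  · exact hp (hs.2 hxp h)

variable (h : IsSurfacePoset r)

include h in
lemma exists_cellMap (d : ℕ) (c : {s : P // r s = d}) :
    ∃ f : (Fin d → ℝ) → OrderComplex P, ContinuousOn f (closedBall 0 1) ∧
      InjOn f (closedBall 0 1) ∧ (∀ z ∈ closedBall 0 1, (f z).1 c.1 = 1 - ‖z‖) ∧
      f '' closedBall 0 1 = {x | ∀ p, ¬ p ≤ c.1 → x.1 p = 0} := by
  obtain ⟨s, rfl⟩ := c
  obtain ⟨f, h1, h2, h3, h4⟩ := exists_ball_parametrization (h.cone_Iio s) (lt_irrefl s)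
    (fun p hp => Or.inr (le_of_lt hp))
  refine ⟨f, h1, h2, h3, h4.trans ?_⟩
  ext x
  exact forall_congr' fun p => ⟨fun hh hp => hh (fun e => hp e.le) fun e => hp (le_of_lt e),
    fun hh h1 h2 => hh fun hle => h2 (lt_of_le_of_ne hle h1)⟩

/-- The characteristic map of the cell of an element of the poset. -/
noncomputable def cellMap (d : ℕ) (c : {s : P // r s = d}) : (Fin d → ℝ) → OrderComplex P :=
  (exists_cellMap h d c).choose

lemma continuousOn_cellMap (d : ℕ) (c : {s : P // r s = d}) :
    ContinuousOn (cellMap h d c) (closedBall 0 1) :=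
  (exists_cellMap h d c).choose_spec.1

lemma injOn_cellMap (d : ℕ) (c : {s : P // r s = d}) :
    InjOn (cellMap h d c) (closedBall 0 1) :=
  (exists_cellMap h d c).choose_spec.2.1

lemma cellMap_closedBall (d : ℕ) (c : {s : P // r s = d}) :
    cellMap h d c '' closedBall 0 1 = {x | ∀ p, ¬ p ≤ c.1 → x.1 p = 0} :=
  (exists_cellMap h d c).choose_spec.2.2.2

lemma cellMap_ball (d : ℕ) (c : {s : P // r s = d}) :
    cellMap h d c '' ball 0 1 = {x | (∀ p, ¬ p ≤ c.1 → x.1 p = 0) ∧ x.1 c.1 ≠ 0} :=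
  image_ball_eq (exists_cellMap h d c).choose_spec.2.2.1 (cellMap_closedBall h d c)

lemma cellMap_sphere (d : ℕ) (c : {s : P // r s = d}) :
    cellMap h d c '' sphere 0 1 = {x | (∀ p, ¬ p ≤ c.1 → x.1 p = 0) ∧ x.1 c.1 = 0} :=
  image_sphere_eq (exists_cellMap h d c).choose_spec.2.2.1 (cellMap_closedBall h d c)

lemma cellMap_sphere_eq_iUnion (d : ℕ) (c : {s : P // r s = d}) :
    cellMap h d c '' sphere 0 1 =
      ⋃ (m : ℕ) (c' : {s : P // r s = m}) (_ : c'.1 < c.1), cellMap h m c' '' ball 0 1 := by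
  simp only [cellMap_sphere, cellMap_ball]
  ext x
  simp only [mem_iUnion, mem_ofPred_eq]
  constructor
  · rintro ⟨h1, h2⟩
    obtain ⟨s, hs, hs'⟩ := exists_carrier x
    refine ⟨r s, ⟨s, rfl⟩, lt_of_le_of_ne ?_ ?_, hs', hs⟩
    · by_contra hle
      exact hs (h1 s hle)
    · rintro rfl
      exact hs h2
  · rintro ⟨m, c', hlt, h1, -⟩
    exact ⟨fun p hp => h1 p fun hps => hp (hps.trans hlt.le), h1 _ hlt.not_ge⟩

/-- The cell decomposition of the order complex with one cell for each element of the poset. -/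
@[reducible]
noncomputable def cwComplex : Topology.CWComplex (univ : Set (OrderComplex P)) :=
  Topology.CWComplex.mkFinite _ (fun d => {s : P // r s = d})
    (fun d c => ((injOn_cellMap h d c).mono ball_subset_closedBall).toPartialEquiv (cellMap h d c) _)
    (by
      obtain ⟨N, hN⟩ := (finite_range r).bddAbove
      filter_upwards [Filter.eventually_gt_atTop N] with n hn
      exact ⟨fun c => absurd (hN (mem_range_self c.1)) (by rw [c.2]; omega)⟩)
    (fun d => inferInstance)
    (fun d c => rfl)
    (fun d c => continuousOn_cellMap h d c)
    (fun d c => (continuousOn_cellMap h d c).continuousOn_of_leftInvOn (isCompact_closedBall 0 1)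
      (injOn_cellMap h d c) ball_subset_closedBall
      (((injOn_cellMap h d c).mono ball_subset_closedBall).toPartialEquiv
        (cellMap h d c) _).leftInvOn)
    (by
      rintro ⟨d, s, rfl⟩ - ⟨e, t, rfl⟩ - hne
      rw [Function.onFun, Set.disjoint_left]
      intro x hx hx'
      have hx1 : x ∈ cellMap h (r s) ⟨s, rfl⟩ '' ball 0 1 := hx
      have hx2 : x ∈ cellMap h (r t) ⟨t, rfl⟩ '' ball 0 1 := hx'
      rw [cellMap_ball] at hx1 hx2
      refine hne ?_
      have : s = t := le_antisymm (not_not.mp fun hle => hx1.2 (hx2.1 s hle))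
        (not_not.mp fun hle => hx2.2 (hx1.1 t hle))
      subst this
      rfl)
    (fun d c => by
      rw [mapsTo_iff_image_subset]
      change cellMap h d c '' sphere 0 1 ⊆
        ⋃ (m < d) (j : {s : P // r s = m}), cellMap h m j '' closedBall 0 1
      rw [cellMap_sphere_eq_iUnion]
      refine iUnion_subset fun m => iUnion_subset fun c' => iUnion_subset fun hlt => ?_
      have hm : m < d := by
        have := h.strictMono hlt
        rwa [c.2, c'.2] at this
      exact (image_mono ball_subset_closedBall).trans (subset_iUnion₂_of_subset m hm
        (subset_iUnion (fun j => cellMap h m j '' closedBall 0 1) c')))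
    (by
      refine eq_univ_of_forall fun x => ?_
      obtain ⟨s, -, hs⟩ := exists_carrier x
      refine mem_iUnion.mpr ⟨r s, mem_iUnion.mpr ⟨⟨s, rfl⟩, ?_⟩⟩
      change x ∈ cellMap h (r s) ⟨s, rfl⟩ '' closedBall 0 1
      rw [cellMap_closedBall]
      exact hs)

lemma finite_cwComplex :
    letI := cwComplex h
    Topology.RelCWComplex.Finite (univ : Set (OrderComplex P)) :=
  Topology.CWComplex.finite_mkFinite ..

lemma isRegularCellDecomposition_cwComplex :
    letI := cwComplex h
    IsRegularCellDecomposition (OrderComplex P) := by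
  intro d c
  constructor
  · have : CompactSpace (closedBall (0 : Fin d → ℝ) 1) :=
      isCompact_iff_compactSpace.mp (isCompact_closedBall 0 1)
    exact (Continuous.isClosedEmbedding
      (continuousOn_iff_continuous_domRestrict.mp (continuousOn_cellMap h d c))
      (injOn_iff_injective.mp (injOn_cellMap h d c))).isEmbedding
  · refine ⟨{t : Σ m, {s : P // r s = m} | t.2.1 < Subtype.val (p := fun s => r s = d) c}, ?_⟩
    refine (cellMap_sphere_eq_iUnion h d c).trans ?_
    ext x
    simp only [mem_iUnion]
    exact ⟨fun ⟨m, c', hlt, hx⟩ => ⟨⟨m, c'⟩, hlt, hx⟩, fun ⟨⟨m, c'⟩, hlt, hx⟩ => ⟨m, c', hlt, hx⟩⟩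

lemma face_iff {d e : ℕ} (c : {s : P // r s = d}) (c' : {s : P // r s = e}) :
    cellMap h d c '' closedBall 0 1 ⊆ cellMap h e c' '' closedBall 0 1 ↔ c.1 ≤ c'.1 := by
  rw [cellMap_closedBall, cellMap_closedBall]
  constructor
  · intro hsub
    by_contra hle
    have := hsub (a := vertex c.1) (fun p hp => vertex_of_ne fun e => hp e.le) c.1 hle
    rw [vertex_self] at this
    exact one_ne_zero this
  · intro hle x hx p hp
    exact hx p fun hpc => hp (hpc.trans hle)

end OrderComplex

/-! ### The order complex as a closed surface -/

namespace OrderComplex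

variable {P : Type} [Fintype P] [PartialOrder P] {r : P → ℕ}

lemma connectedSpace (h : IsSurfacePoset r) : ConnectedSpace (OrderComplex P) := by
  have hpre : ∀ s : P, IsPreconnected {x : OrderComplex P | ∀ p, ¬ p ≤ s → x.1 p = 0} := by
    intro s
    rw [← cellMap_closedBall h (r s) ⟨s, rfl⟩]
    exact (convex_closedBall 0 1).isPreconnected.image _ (continuousOn_cellMap h _ _)
  have hU : (⋃ s : P, {x : OrderComplex P | ∀ p, ¬ p ≤ s → x.1 p = 0}) = univ :=
    eq_univ_of_forall fun x => mem_iUnion.mpr ((exists_carrier x).imp fun s hs => hs.2)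
  have hvert : ∀ s t : P, s ≤ t → ∀ p, ¬ p ≤ t → (vertex s).1 p = 0 :=
    fun s t hst p hp => vertex_of_ne fun e => hp (e.le.trans hst)
  have hconn := IsPreconnected.iUnion_of_reflTransGen hpre fun s t =>
    Relation.ReflTransGen.mono (fun a b hab => by
      rcases hab with hab | hab
      · exact ⟨vertex a, hvert a a le_rfl, hvert a b hab⟩
      · exact ⟨vertex b, hvert b a hab, hvert b b le_rfl⟩) _ _ (h.connected s t)
  rw [hU] at hconn
  obtain ⟨s⟩ := h.nonempty
  exact { isPreconnected_univ := hconn, toNonempty := ⟨vertex s⟩ }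

/-- The open star of `s` is a coordinate disc, because the link of `s` is a circle. -/
lemma exists_chart (h : IsSurfacePoset r) (s : P) :
    ∃ φ : OpenPartialHomeomorph (OrderComplex P) (EuclideanSpace ℝ (Fin 2)),
      φ.source = {x | x.1 s ≠ 0} := by
  obtain ⟨f, hc, hi, hs, hS⟩ := exists_ball_parametrization (h.cone_link s) (fun hs => hs.1 rfl)
    (fun p hp => hp.2)
  have hball : f '' ball 0 1 = {x | x.1 s ≠ 0} := by
    rw [image_ball_eq hs hS]
    ext x
    refine ⟨fun hx => hx.2, fun hx => ⟨fun p hps hp => ?_, hx⟩⟩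
    by_contra hxp
    exact hp ⟨hps, x.2.2.2 s p hx hxp⟩
  have hinj := hi.mono ball_subset_closedBall
  let φ : OpenPartialHomeomorph (Fin 2 → ℝ) (OrderComplex P) :=
    { hinj.toPartialEquiv f (ball 0 1) with
      open_source := isOpen_ball
      open_target := by
        change IsOpen (f '' ball 0 1)
        rw [hball]
        exact isOpen_ne_fun (continuous_coord s) continuous_const
      continuousOn_toFun := hc.mono ball_subset_closedBall
      continuousOn_invFun := hc.continuousOn_of_leftInvOn (isCompact_closedBall 0 1) hi
        ball_subset_closedBall (hinj.toPartialEquiv f (ball 0 1)).leftInvOn }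
  refine ⟨φ.symm.transHomeomorph (EuclideanSpace.equiv (Fin 2) ℝ).symm.toHomeomorph, ?_⟩
  exact hball

lemma isClosedSurface (h : IsSurfacePoset r) : IsClosedSurface (OrderComplex P) := by
  refine ⟨inferInstance, connectedSpace h, inferInstance, inferInstance, ?_⟩
  choose φ hφ using exists_chart h
  choose c hc using exists_carrier (P := P)
  exact ⟨{
    atlas := range φ
    chartAt := fun x => φ (c x)
    mem_chart_source := fun x => by
      rw [hφ]
      exact (hc x).1
    chart_mem_atlas := fun x => mem_range_self _ }⟩

end OrderComplex

/-! ### Connected `2`-regular relations -/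

/-- A finite connected `2`-regular relation is a cycle: a walk that never turns back first returns
to its starting point, and has then visited everything. -/
lemma exists_cyclic_enumeration {P : Type*} {R : P → P → Prop} {L : Set P} (hfin : L.Finite)
    (hne : L.Nonempty) (hsymm : ∀ x y, R x y → R y x)
    (hreg : ∀ x ∈ L, ∃ y ∈ L, ∃ z ∈ L, y ≠ z ∧ ∀ w ∈ L, (x ≠ w ∧ R x w) ↔ w = y ∨ w = z)
    (hconn : ∀ S ⊆ L, S.Nonempty → (∀ x ∈ S, ∀ y ∈ L, R x y → y ∈ S) → S = L) :
    ∃ (m : ℕ) (a : ℕ → P), BijOn a (Iio m) L ∧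
      ∀ i < m, ∀ j < m, i ≠ j → (R (a i) (a j) ↔ CycAdj m i j) := by
  let D := {p : P × P // p.1 ∈ L ∧ p.2 ∈ L ∧ p.1 ≠ p.2 ∧ R p.1 p.2}
  have hstep : ∀ p : D, ∃ q : D, q.1.1 = p.1.2 ∧ q.1.2 ≠ p.1.1 ∧
      ∀ w ∈ L, q.1.1 ≠ w → R q.1.1 w → w = p.1.1 ∨ w = q.1.2 := by
    rintro ⟨⟨x, y⟩, hx, hy, hxy, hR⟩
    obtain ⟨u, hu, v, hv, huv, hw⟩ := hreg y hy
    rcases (hw x hx).mp ⟨hxy.symm, hsymm _ _ hR⟩ with rfl | rfl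
    · have := (hw v hv).mpr (Or.inr rfl)
      exact ⟨⟨(y, v), hy, hv, this⟩, rfl, huv.symm, fun w hwL h1 h2 => (hw w hwL).mp ⟨h1, h2⟩⟩
    · have := (hw u hu).mpr (Or.inl rfl)
      exact ⟨⟨(y, u), hy, hu, this⟩, rfl, huv, fun w hwL h1 h2 => ((hw w hwL).mp ⟨h1, h2⟩).symm⟩
  choose step h1 h2 h3 using hstep
  obtain ⟨d⟩ : Nonempty D := by
    obtain ⟨x, hx⟩ := hne
    obtain ⟨y, hy, z, hz, hyz, hw⟩ := hreg x hx
    exact ⟨⟨(x, y), hx, hy, (hw y hy).mpr (Or.inl rfl)⟩⟩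
  let s : ℕ → D := fun n => step^[n] d
  obtain ⟨a, ha⟩ : ∃ a : ℕ → P, ∀ n, a n = (s n).1.1 := ⟨_, fun _ => rfl⟩
  have hs : ∀ n, s (n + 1) = step (s n) := fun n => Function.iterate_succ_apply' step n d
  have ha' : ∀ n, (s n).1.2 = a (n + 1) := fun n => by rw [ha, hs, h1]
  have haL : ∀ n, a n ∈ L := fun n => ha n ▸ (s n).2.1
  have hne1 : ∀ n, a n ≠ a (n + 1) := fun n => by
    rw [← ha', ha]
    exact (s n).2.2.2.1
  have hR1 : ∀ n, R (a n) (a (n + 1)) := fun n => by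
    rw [← ha', ha]
    exact (s n).2.2.2.2
  have hne2 : ∀ n, a (n + 2) ≠ a n := fun n => by
    rw [← ha' (n + 1), hs, ha]
    exact h2 _
  have hnb : ∀ n, ∀ w ∈ L, a (n + 1) ≠ w → R (a (n + 1)) w → w = a n ∨ w = a (n + 2) := by
    intro n
    rw [← ha' (n + 1), ha n, ha (n + 1), hs]
    exact h3 (s n)
  clear_value s
  clear ha ha' hs h1 h2 h3 step
  have hrep : ∃ n, ∃ i < n, a i = a n := by
    obtain ⟨i, -, j, -, hij, h⟩ := infinite_univ.exists_ne_map_eq_of_mapsTo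
      (fun n _ => haL n : MapsTo a univ L) hfin
    rcases lt_or_gt_of_ne hij with hlt | hlt
    · exact ⟨j, i, hlt, h⟩
    · exact ⟨i, j, hlt, h.symm⟩
  classical
  obtain ⟨m, ⟨i, him, hi⟩, hmin⟩ : ∃ m, (∃ i < m, a i = a m) ∧ ∀ n < m, ¬ ∃ i < n, a i = a n :=
    ⟨Nat.find hrep, Nat.find_spec hrep, fun n hn => Nat.find_min hrep hn⟩
  have hinj : ∀ i < m, ∀ j < m, a i = a j → i = j := by
    intro i hi j hj h
    by_contra hij
    rcases lt_or_gt_of_ne hij with hlt | hlt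
    · exact hmin j hj ⟨i, hlt, h⟩
    · exact hmin i hi ⟨j, hlt, h.symm⟩
  obtain ⟨k, rfl⟩ : ∃ k, m = k + 1 := ⟨m - 1, by omega⟩
  -- The walk closes up at its starting point, since an interior vertex has no third neighbour.
  have h0 : a 0 = a (k + 1) := by
    rcases i with _ | i
    · exact hi
    · exfalso
      rcases hnb i (a k) (haL k) (by rw [hi]; exact (hne1 k).symm)
        (by rw [hi]; exact hsymm _ _ (hR1 k)) with h | h
      · have := hinj k (by omega) i (by omega) h
        omega
      · rcases Nat.lt_or_ge (i + 2) (k + 1) with hlt | hge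
        · have := hinj k (by omega) (i + 2) hlt h
          subst this
          exact hne2 (i + 1) hi.symm
        · have : i + 1 = k := by omega
          subst this
          exact hne1 _ hi
  have hk : 2 ≤ k := by
    rcases k with _ | _ | k
    · exact absurd h0 (hne1 0)
    · exact absurd h0.symm (hne2 0)
    · omega
  have hnb0 : ∀ w ∈ L, a 0 ≠ w → R (a 0) w → w = a k ∨ w = a 1 := by
    intro w hw hne hRw
    have h1 : a 1 = a (k + 2) := by
      rcases hnb k (a 1) (haL 1) (h0 ▸ hne1 0) (h0 ▸ hR1 0) with h | h
      · have := hinj 1 (by omega) k (by omega) h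
        omega
      · exact h
    rw [h1]
    exact hnb k w hw (h0 ▸ hne) (h0 ▸ hRw)
  have himage : a '' Iio (k + 1) = L := by
    refine hconn _ ?_ ⟨a 0, 0, by simp, rfl⟩ ?_
    · rintro _ ⟨n, -, rfl⟩
      exact haL n
    · rintro _ ⟨n, hn, rfl⟩ y hy hRy
      rw [mem_Iio] at hn
      by_cases hny : a n = y
      · exact ⟨n, hn, hny⟩
      · rcases n with _ | n
        · rcases hnb0 y hy hny hRy with rfl | rfl
          · exact ⟨k, by simp, rfl⟩
          · exact ⟨1, by simp; omega, rfl⟩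
        · rcases hnb n y hy hny hRy with rfl | rfl
          · exact ⟨n, by simp; omega, rfl⟩
          · by_cases hnk : n + 1 = k
            · exact ⟨0, by simp, by rw [h0, ← hnk]⟩
            · exact ⟨n + 2, by simp; omega, rfl⟩
  refine ⟨k + 1, a, ⟨fun n _ => haL n, fun i hi j hj h => hinj i hi j hj h, himage.ge⟩, ?_⟩
  intro i hi j hj hij
  constructor
  · intro hRij
    have hne : a i ≠ a j := fun h => hij (hinj i hi j hj h)
    unfold CycAdj
    rcases i with _ | i
    · rcases hnb0 _ (haL j) hne hRij with h | h
      · have := hinj j hj k (by omega) h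
        omega
      · have := hinj j hj 1 (by omega) h
        omega
    · rcases hnb i _ (haL j) hne hRij with h | h
      · have := hinj j hj i (by omega) h
        omega
      · by_cases hik : i + 1 = k
        · rw [← hik] at h0
          have := hinj j hj 0 (by omega) (h.trans h0.symm)
          omega
        · have := hinj j hj (i + 2) (by omega) h
          omega
  · rintro (rfl | rfl | ⟨rfl, h⟩ | ⟨rfl, h⟩)
    · exact hR1 i
    · exact hsymm _ _ (hR1 j)
    · obtain rfl : j = k := by omega
      exact h0 ▸ hsymm _ _ (hR1 j)
    · obtain rfl : i = k := by omega
      exact h0 ▸ hR1 i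

/-! ### Nests as components -/

lemma LinearIndepOn.finrank_span_image {ι K M : Type*} [Field K] [AddCommGroup M] [Module K M]
    {f : ι → M} {S : Set ι} (h : LinearIndepOn K f S) (hS : S.Finite) :
    Module.finrank K (Submodule.span K (f '' S)) = S.ncard := by
  have := hS.fintype
  rw [image_eq_range, finrank_span_eq_card h, ← Nat.card_eq_fintype_card, Nat.card_coe_set_eq]

namespace Graph

variable {V E : Type*} {n : ℕ} {Γ : Graph V E} {α : E → ColorSpace n}

/-- The relation of being joined by an edge whose color lies in `W`. -/
def ColorAdj (Γ : Graph V E) (α : E → ColorSpace n) (W : Submodule (ZMod 2) (ColorSpace n))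
    (x y : V) : Prop :=
  ∃ e, Γ.IsLink e x y ∧ α e ∈ W

/-- The component of `v` in the subgraph of the edges with color in `W`. -/
def colorComponent (Γ : Graph V E) (α : E → ColorSpace n)
    (W : Submodule (ZMod 2) (ColorSpace n)) (v : V) : Graph V E where
  vertexSet := {x | Relation.ReflTransGen (Γ.ColorAdj α W) v x}
  IsLink e x y := (Γ.IsLink e x y ∧ α e ∈ W) ∧ Relation.ReflTransGen (Γ.ColorAdj α W) v x
  isLink_symm := fun e _ => ⟨fun _ _ h => ⟨⟨h.1.1.symm, h.1.2⟩, h.2.tail ⟨e, h.1⟩⟩⟩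
  eq_or_eq_of_isLink_of_isLink := fun _ _ _ _ _ h h' => h.1.1.left_eq_or_eq h'.1.1
  left_mem_of_isLink := fun _ _ _ h => h.2

section component

variable {W : Submodule (ZMod 2) (ColorSpace n)} {v : V}

lemma self_mem_colorComponent : v ∈ V(Γ.colorComponent α W v) := Relation.ReflTransGen.refl

lemma colorComponent_isLink {e : E} {x y : V} : (Γ.colorComponent α W v).IsLink e x y ↔
    (Γ.IsLink e x y ∧ α e ∈ W) ∧ x ∈ V(Γ.colorComponent α W v) := Iff.rfl

lemma colorComponent_inc {e : E} {x : V} : (Γ.colorComponent α W v).Inc e x ↔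
    Γ.Inc e x ∧ α e ∈ W ∧ x ∈ V(Γ.colorComponent α W v) := by
  simp only [Inc, colorComponent_isLink, exists_and_right, and_assoc]

lemma color_mem_of_mem_colorComponent {e : E} (he : e ∈ E(Γ.colorComponent α W v)) : α e ∈ W := by
  obtain ⟨x, y, h⟩ := exists_isLink_of_mem_edgeSet he
  exact h.1.2

lemma colorComponent_le (hv : v ∈ V(Γ)) : Γ.colorComponent α W v ≤ Γ := by
  refine ⟨fun x hx => ?_, fun e x y h => h.1.1⟩
  induction hx with
  | refl => exact hv
  | tail _ h _ => exact h.choose_spec.1.right_mem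

lemma reflTransGen_adj_symm {Δ : Graph V E} {x y : V} (h : Relation.ReflTransGen Δ.Adj x y) :
    Relation.ReflTransGen Δ.Adj y x := by
  induction h with
  | refl => exact .refl
  | tail _ h ih => exact .head h.symm ih

lemma isConn_of_forall_reflTransGen {Δ : Graph V E} (hv : v ∈ V(Δ))
    (h : ∀ x ∈ V(Δ), Relation.ReflTransGen Δ.Adj v x) : Δ.IsConn :=
  ⟨⟨v, hv⟩, fun x hx y hy => (reflTransGen_adj_symm (h x hx)).trans (h y hy)⟩

lemma isConn_colorComponent : (Γ.colorComponent α W v).IsConn := by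
  refine isConn_of_forall_reflTransGen self_mem_colorComponent fun x hx => ?_
  induction hx with
  | refl => exact .refl
  | tail hb h ih =>
    obtain ⟨e, he⟩ := h
    exact ih.tail ⟨e, he, hb⟩

lemma le_colorComponent {Δ : Graph V E} (hΔ : Δ ≤ Γ) (hc : Δ.IsConn) (hv : v ∈ V(Δ))
    (hW : ∀ e ∈ E(Δ), α e ∈ W) : Δ ≤ Γ.colorComponent α W v := by
  have hreach : ∀ x ∈ V(Δ), x ∈ V(Γ.colorComponent α W v) := fun x hx =>
    Relation.ReflTransGen.mono (fun a b hab => by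
      obtain ⟨e, he⟩ := hab
      exact ⟨e, he.mono hΔ, hW e he.edge_mem⟩) _ _ (hc.2 v hv x hx)
  exact ⟨hreach, fun e x y h => ⟨⟨h.mono hΔ, hW e h.edge_mem⟩, hreach x h.left_mem⟩⟩

/-- A nest is the component of the edges with color in its span. -/
lemma IsNest.eq_colorComponent {k : ℕ} {Δ : Graph V E} (h : Γ.IsNest α k Δ) (hv : v ∈ V(Δ)) :
    Δ = Γ.colorComponent α (Submodule.span (ZMod 2) (α '' E(Δ))) v := by
  obtain ⟨hlt, hc, hk, hmax⟩ := h
  have hle := le_colorComponent (α := α) hlt.le hc hv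
    fun e he => Submodule.subset_span (mem_image_of_mem α he)
  by_contra hne
  have h1 := hmax _ (colorComponent_le (hlt.le.vertexSet_mono hv)) isConn_colorComponent
    (lt_of_le_of_ne hle hne)
  rw [← hk] at h1
  refine absurd h1 (not_lt.mpr (Submodule.finrank_mono (Submodule.span_le.mpr ?_)))
  rintro _ ⟨e, he, rfl⟩
  exact color_mem_of_mem_colorComponent he

end component

lemma IsNest.eq_of_le {k l : ℕ} {Δ Δ' : Graph V E} (h : Γ.IsNest α k Δ) (h' : Γ.IsNest α l Δ')
    (hle : Δ ≤ Δ') (hlk : l ≤ k) : Δ = Δ' := by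
  by_contra hne
  have := h.2.2.2 Δ' h'.1.le h'.2.1 (lt_of_le_of_ne hle hne)
  rw [h'.2.2.1] at this
  omega

section coloring

variable (hα : Γ.IsColoring α)
include hα

lemma IsColoring.ne {e : E} {x y : V} (h : Γ.IsLink e x y) : x ≠ y := by
  rintro rfl
  exact (hα x h.left_mem).1 e h

lemma IsColoring.color_mem_span_iff {v : V} {S : Set E} (hS : ∀ e ∈ S, Γ.Inc e v) {e : E}
    (he : Γ.Inc e v) : α e ∈ Submodule.span (ZMod 2) (α '' S) ↔ e ∈ S := by
  have hi := (hα v he.vertex_mem).2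
  rw [(hi.mono hS).mem_span_iff]
  exact ⟨fun h => h (hi.mono (insert_subset he hS)), fun h _ => h⟩

lemma IsColoring.color_ne_zero {e : E} (he : e ∈ E(Γ)) : α e ≠ 0 := by
  obtain ⟨x, y, h⟩ := exists_isLink_of_mem_edgeSet he
  exact (hα x h.left_mem).2.ne_zero h.inc_left

/-- The edges at a vertex with color in the span of some edges at that vertex are those edges. -/
lemma IsColoring.colorComponent_inc_self {v : V} {S : Set E} (hS : ∀ e ∈ S, Γ.Inc e v) {e : E} :
    (Γ.colorComponent α (Submodule.span (ZMod 2) (α '' S)) v).Inc e v ↔ e ∈ S := by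
  rw [colorComponent_inc]
  constructor
  · rintro ⟨h1, h2, -⟩
    exact (hα.color_mem_span_iff hS h1).mp h2
  · intro h
    exact ⟨hS e h, Submodule.subset_span (mem_image_of_mem α h), self_mem_colorComponent⟩

/-- Every proper subset of the edges at a vertex spans a nest. -/
lemma IsColoring.isNest_colorComponent {v : V} (hv : v ∈ V(Γ)) {S : Set E} (hfin : S.Finite)
    (hS : ∀ e ∈ S, Γ.Inc e v) (hproper : ∃ e, Γ.Inc e v ∧ e ∉ S) :
    Γ.IsNest α S.ncard (Γ.colorComponent α (Submodule.span (ZMod 2) (α '' S)) v) := by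
  have hspan : Submodule.span (ZMod 2)
      (α '' E(Γ.colorComponent α (Submodule.span (ZMod 2) (α '' S)) v)) =
      Submodule.span (ZMod 2) (α '' S) := by
    refine le_antisymm (Submodule.span_le.mpr ?_) (Submodule.span_mono (image_mono fun e he => ?_))
    · rintro _ ⟨e, he, rfl⟩
      exact color_mem_of_mem_colorComponent he
    · exact ((hα.colorComponent_inc_self hS).mpr he).edge_mem
  have hrank := ((hα v hv).2.mono hS).finrank_span_image hfin
  refine ⟨lt_of_le_of_ne (colorComponent_le hv) fun heq => ?_, isConn_colorComponent, ?_, ?_⟩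
  · obtain ⟨e, he, heS⟩ := hproper
    refine heS ((hα.colorComponent_inc_self hS).mp ?_)
    rwa [heq]
  · rw [colorDim, hspan, hrank]
  · intro Δ hΔ hc hlt
    by_contra hle
    rw [not_lt] at hle
    have hsub : Submodule.span (ZMod 2) (α '' S) ≤ Submodule.span (ZMod 2) (α '' E(Δ)) := by
      rw [← hspan]
      exact Submodule.span_mono (image_mono hlt.le.edgeSet_mono)
    have heq := Submodule.eq_of_le_of_finrank_le hsub (by rw [hrank]; exact hle)
    refine hlt.not_ge (le_colorComponent hΔ hc (hlt.le.vertexSet_mono self_mem_colorComponent) ?_)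
    intro e he
    rw [heq]
    exact Submodule.subset_span (mem_image_of_mem α he)

/-- A nest of dimension `0` is a vertex. -/
lemma IsColoring.vertexSet_edgeSet_of_isNest_zero {Δ : Graph V E} (h : Γ.IsNest α 0 Δ) {v : V}
    (hv : v ∈ V(Δ)) : V(Δ) = {v} ∧ E(Δ) = ∅ := by
  have hE : E(Δ) = ∅ := by
    refine eq_empty_of_forall_notMem fun e he => ?_
    have h0 := Submodule.finrank_eq_zero.mp h.2.2.1
    rw [Submodule.span_eq_bot] at h0
    exact hα.color_ne_zero (h.1.le.edgeSet_mono he) (h0 _ (mem_image_of_mem α he))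
  refine ⟨eq_singleton_iff_unique_mem.mpr ⟨hv, fun x hx => ?_⟩, hE⟩
  rcases (h.2.1.2 x hx v hv).cases_head with h1 | ⟨y, ⟨e, he⟩, -⟩
  · exact h1
  · exact absurd he.edge_mem (by rw [hE]; exact notMem_empty e)

/-- A nest of dimension `1` is an edge with its ends. -/
lemma IsColoring.vertexSet_edgeSet_of_isNest_one {Δ : Graph V E} (h : Γ.IsNest α 1 Δ) {e : E}
    (he : e ∈ E(Δ)) : V(Δ) = {x | Γ.Inc e x} ∧ E(Δ) = {e} := by
  have hΔ := h.1.le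
  have hspan : ∀ g ∈ E(Δ), α g ∈ Submodule.span (ZMod 2) (α '' {e}) := by
    intro g hg
    have hle : Submodule.span (ZMod 2) (α '' {e}) ≤ Submodule.span (ZMod 2) (α '' E(Δ)) :=
      Submodule.span_mono (image_mono (singleton_subset_iff.mpr he))
    have heq := Submodule.eq_of_le_of_finrank_le hle (by
      rw [image_singleton, finrank_span_singleton (hα.color_ne_zero (hΔ.edgeSet_mono he))]
      exact h.2.2.1.le)
    rw [heq]
    exact Submodule.subset_span (mem_image_of_mem α hg)
  have hone : ∀ g x, Δ.Inc g x → Γ.Inc e x → g = e := fun g x hg hx =>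
    (hα.color_mem_span_iff (S := {e}) (by simpa using hx) (hg.mono hΔ)).mp (hspan g hg.edge_mem)
  obtain ⟨v, w, hvw⟩ := exists_isLink_of_mem_edgeSet he
  have hinc : ∀ x ∈ V(Δ), Γ.Inc e x := by
    intro x hx
    have := h.2.1.2 v hvw.left_mem x hx
    induction this with
    | refl => exact hvw.inc_left.mono hΔ
    | tail _ hbc ih =>
      obtain ⟨g, hg⟩ := hbc
      have := hone g _ hg.inc_left (ih hg.left_mem)
      subst this
      exact hg.inc_right.mono hΔ
  refine ⟨Subset.antisymm hinc fun x hx => ?_, eq_singleton_iff_unique_mem.mpr ⟨he, fun g hg => ?_⟩⟩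
  · exact ((IsSubgraph.inc_congr hΔ he).mpr hx).vertex_mem
  · obtain ⟨x, y, hxy⟩ := exists_isLink_of_mem_edgeSet hg
    exact hone g x hxy.inc_left (hinc x hxy.left_mem)

end coloring

end Graph

/-! ### Nests of dimension two -/

namespace Graph

variable {V E : Type*} {n : ℕ} {Γ : Graph V E} {α : E → ColorSpace n}

/-- The component of a corner: the edges whose color is a combination of the colors of the edges
`g` and `g'` at `x`, as far as they can be reached from `x`. -/
noncomputable def face (Γ : Graph V E) (α : E → ColorSpace n) (x : V) (g g' : E) : Graph V E :=
  Γ.colorComponent α (Submodule.span (ZMod 2) (α '' {g, g'})) x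

lemma face_comm (x : V) (g g' : E) : Γ.face α x g g' = Γ.face α x g' g := by
  rw [face, face, pair_comm]

lemma self_mem_face {x : V} {g g' : E} : x ∈ V(Γ.face α x g g') := self_mem_colorComponent

/-- Goodness carries a corner across an edge: this is what makes the components of corners
`2`-valent. -/
lemma IsGoodColoring.exists_corner_of_mem (hα : Γ.IsGoodColoring α) {x u : V} {g g' : E}
    (hg : Γ.Inc g x) (hg' : Γ.Inc g' x) (hne : g ≠ g') (hu : u ∈ V(Γ.face α x g g')) :
    ∃ h h', h ≠ h' ∧ Γ.Inc h u ∧ Γ.Inc h' u ∧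
      Submodule.span (ZMod 2) (α '' {g, g'}) = Submodule.span (ZMod 2) (α '' {h, h'}) := by
  induction hu with
  | refl => exact ⟨g, g', hne, hg, hg', rfl⟩
  | @tail a b _ hab ih =>
    obtain ⟨e, he, heW⟩ := hab
    obtain ⟨e₀, hne₀, he₀, hW⟩ : ∃ e₀, e₀ ≠ e ∧ Γ.Inc e₀ a ∧
        Submodule.span (ZMod 2) (α '' {g, g'}) = Submodule.span (ZMod 2) {α e₀, α e} := by
      obtain ⟨h, h', hne, hh, hh', hW⟩ := ih
      rw [hW, hα.1.color_mem_span_iff (by rintro _ (rfl | rfl) <;> assumption) he.inc_left] at heW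
      rcases heW with rfl | rfl
      · exact ⟨h', hne.symm, hh', by rw [hW, image_pair, pair_comm]⟩
      · exact ⟨h, hne, hh, by rw [hW, image_pair]⟩
    obtain ⟨e₂, ⟨he₂, hspan⟩, -⟩ := hα.2 e a b he e₀ he₀
    refine ⟨e, e₂, ?_, he.inc_right, he₂, by rw [hW, hspan, image_pair]⟩
    rintro rfl
    rw [pair_eq_singleton, ← image_singleton] at hspan
    have : α e₀ ∈ Submodule.span (ZMod 2) (α '' {e}) := by
      rw [← hspan]
      exact Submodule.subset_span (mem_insert _ _)
    exact hne₀ ((hα.1.color_mem_span_iff (by rintro _ rfl; exact he.inc_left) he₀).mp this)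

lemma IsNest.edgeSet_nonempty {k : ℕ} {Δ : Graph V E} (h : Γ.IsNest α k Δ) (hk : k ≠ 0) :
    E(Δ).Nonempty := by
  by_contra hempty
  refine hk (h.2.2.1.symm.trans ?_)
  rw [colorDim, not_nonempty_iff_eq_empty.mp hempty, image_empty, Submodule.span_empty, finrank_bot]

lemma IsColoring.exists_corner_of_isNest_two (hα : Γ.IsColoring α) {Δ : Graph V E}
    (h : Γ.IsNest α 2 Δ) : ∃ u g g', g ≠ g' ∧ Δ.Inc g u ∧ Δ.Inc g' u := by
  by_contra! hcon
  have hone : ∀ u g g', Δ.Inc g u → Δ.Inc g' u → g = g' := fun u g g' hg hg' => by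
    by_contra hne
    exact hcon u g g' hne hg hg'
  obtain ⟨e, he⟩ := h.edgeSet_nonempty two_ne_zero
  obtain ⟨v, w, hvw⟩ := exists_isLink_of_mem_edgeSet he
  have hinc : ∀ x ∈ V(Δ), Δ.Inc e x := by
    intro x hx
    have := h.2.1.2 v hvw.left_mem x hx
    induction this with
    | refl => exact hvw.inc_left
    | tail _ hbc ih =>
      obtain ⟨g, hg⟩ := hbc
      have := hone _ _ _ hg.inc_left (ih hg.left_mem)
      subst this
      exact hg.inc_right
  have hE : E(Δ) = {e} := by
    refine eq_singleton_iff_unique_mem.mpr ⟨he, fun g hg => ?_⟩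
    obtain ⟨x, y, hxy⟩ := exists_isLink_of_mem_edgeSet hg
    exact hone x g e hxy.inc_left (hinc x hxy.left_mem)
  have h2 := h.2.2.1
  rw [colorDim, hE, image_singleton,
    finrank_span_singleton (hα.color_ne_zero (h.1.le.edgeSet_mono he))] at h2
  omega

/-- A nest of dimension `2` is the component of each of its corners. -/
lemma IsGoodColoring.exists_eq_face (hα : Γ.IsGoodColoring α) {Δ : Graph V E}
    (h : Γ.IsNest α 2 Δ) {x : V} (hx : x ∈ V(Δ)) :
    ∃ g g', g ≠ g' ∧ Γ.Inc g x ∧ Γ.Inc g' x ∧ Δ = Γ.face α x g g' := by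
  obtain ⟨u, g, g', hne, hg, hg'⟩ := hα.1.exists_corner_of_isNest_two h
  have hgΓ := hg.mono h.1.le
  have hgΓ' := hg'.mono h.1.le
  have hpair : ∀ e ∈ ({g, g'} : Set E), Γ.Inc e u := by rintro _ (rfl | rfl) <;> assumption
  have hsub : Submodule.span (ZMod 2) (α '' {g, g'}) ≤ Submodule.span (ZMod 2) (α '' E(Δ)) :=
    Submodule.span_mono (image_mono (insert_subset hg.edge_mem
      (singleton_subset_iff.mpr hg'.edge_mem)))
  have hspan := Submodule.eq_of_le_of_finrank_le hsub (by
    rw [((hα.1 u hgΓ.vertex_mem).2.mono hpair).finrank_span_image (toFinite _), ncard_pair hne]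
    exact h.2.2.1.le)
  have hu := h.eq_colorComponent hg.vertex_mem
  rw [← hspan] at hu
  obtain ⟨k, k', hkne, hk, hk', hW⟩ := hα.exists_corner_of_mem hgΓ hgΓ' hne
    (u := x) (by rw [face, ← hu]; exact hx)
  refine ⟨k, k', hkne, hk, hk', ?_⟩
  have := h.eq_colorComponent hx
  rwa [← hspan, hW] at this

lemma IsColoring.face_inc_self (hα : Γ.IsColoring α) {x : V} {g g' e : E}
    (hg : Γ.Inc g x) (hg' : Γ.Inc g' x) : (Γ.face α x g g').Inc e x ↔ e = g ∨ e = g' :=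
  hα.colorComponent_inc_self (by rintro _ (rfl | rfl) <;> assumption)

lemma IsColoring.isNest_face (hα : Γ.IsColoring α) {x : V} {g g' e : E} (hne : g ≠ g')
    (hg : Γ.Inc g x) (hg' : Γ.Inc g' x) (he : Γ.Inc e x) (heg : e ≠ g) (heg' : e ≠ g') :
    Γ.IsNest α 2 (Γ.face α x g g') := by
  rw [← ncard_pair hne]
  exact hα.isNest_colorComponent hg.vertex_mem (toFinite _)
    (by rintro _ (rfl | rfl) <;> assumption) ⟨e, he, by simp [heg, heg']⟩

lemma IsGoodColoring.exists_inc_iff_of_isNest_two (hα : Γ.IsGoodColoring α) {Δ : Graph V E}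
    (h : Γ.IsNest α 2 Δ) {x : V} (hx : x ∈ V(Δ)) :
    ∃ g g', g ≠ g' ∧ ∀ e, Δ.Inc e x ↔ e = g ∨ e = g' := by
  obtain ⟨g, g', hne, hg, hg', rfl⟩ := hα.exists_eq_face h hx
  exact ⟨g, g', hne, fun e => hα.1.face_inc_self hg hg'⟩

/-- A nest of dimension `2` is a circle. -/
lemma IsGoodColoring.isCircle_of_isNest_two (hα : Γ.IsGoodColoring α) (hV : V(Γ).Finite)
    (hE : E(Γ).Finite) {Δ : Graph V E} (h : Γ.IsNest α 2 Δ) : Δ.IsCircle := by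
  refine ⟨hV.subset h.1.le.vertexSet_mono, hE.subset h.1.le.edgeSet_mono, h.2.1, fun x hx => ?_⟩
  obtain ⟨g, g', hne, hinc⟩ := hα.exists_inc_iff_of_isNest_two h hx
  have h1 : {e | Δ.Inc e x} = {g, g'} := by
    ext e
    exact hinc e
  have h2 : {e | Δ.IsLoopAt e x} = ∅ := eq_empty_of_forall_notMem fun e he =>
    hα.1.ne (IsLink.mono h.1.le he) rfl
  rw [valence, h1, h2, encard_pair hne, encard_empty, add_zero]
  rfl

lemma IsColoring.exists_inc_iff (hα : Γ.IsColoring α) (hreg : Γ.IsRegularOfValence 3) {x : V}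
    (hx : x ∈ V(Γ)) : ∃ e₀ e₁ e₂, e₀ ≠ e₁ ∧ e₀ ≠ e₂ ∧ e₁ ≠ e₂ ∧
      ∀ e, Γ.Inc e x ↔ e = e₀ ∨ e = e₁ ∨ e = e₂ := by
  have h := hreg x hx
  have h2 : {e | Γ.IsLoopAt e x} = ∅ := eq_empty_of_forall_notMem fun e he => hα.ne he rfl
  rw [valence, h2, encard_empty, add_zero] at h
  obtain ⟨e₀, e₁, e₂, h01, h02, h12, hS⟩ := encard_eq_three.mp h
  exact ⟨e₀, e₁, e₂, h01, h02, h12, fun e => by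
    have := congrArg (e ∈ ·) hS
    simpa using this⟩

end Graph

/-! ### The poset of nests -/

namespace Graph

variable {V E : Type*} {n : ℕ}

/-- The poset `P` is the poset of nests of dimension at most `2`, via `ψ`, and its elements of
ranks `0` and `1` are labelled by the vertices and edges of the graph. The labellings are only
meaningful on `V(Γ)` and `E(Γ)`. -/
structure IsNestPoset {P : Type*} [PartialOrder P] (Γ : Graph V E) (α : E → ColorSpace n)
    (ψ : P → Graph V E) (vtx : V → P) (edg : E → P) : Prop where
  le_iff : ∀ p q, p ≤ q ↔ ψ p ≤ ψ q
  exists_isNest : ∀ p, ∃ d ≤ 2, Γ.IsNest α d (ψ p)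
  exists_eq : ∀ Δ, Γ.IsNest α 2 Δ → ∃ p, ψ p = Δ
  isNest_vtx : ∀ x ∈ V(Γ), Γ.IsNest α 0 (ψ (vtx x))
  mem_vtx : ∀ x ∈ V(Γ), x ∈ V(ψ (vtx x))
  isNest_edg : ∀ e ∈ E(Γ), Γ.IsNest α 1 (ψ (edg e))
  mem_edg : ∀ e ∈ E(Γ), e ∈ E(ψ (edg e))

namespace IsNestPoset

variable {P : Type*} [PartialOrder P] {Γ : Graph V E} {α : E → ColorSpace n}
  {ψ : P → Graph V E} {vtx : V → P} {edg : E → P}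

section

variable (h : IsNestPoset Γ α ψ vtx edg)
include h

lemma injective : Function.Injective ψ := fun p q hpq =>
  le_antisymm ((h.le_iff p q).mpr hpq.le) ((h.le_iff q p).mpr hpq.ge)

lemma le_graph (p : P) : ψ p ≤ Γ := by
  obtain ⟨d, -, hd⟩ := h.exists_isNest p
  exact hd.1.le

lemma eq_of_le {p q : P} {k l : ℕ} (hp : Γ.IsNest α k (ψ p)) (hq : Γ.IsNest α l (ψ q))
    (hlk : l ≤ k) (hpq : p ≤ q) : p = q :=
  h.injective (hp.eq_of_le hq ((h.le_iff p q).mp hpq) hlk)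

lemma not_le {p q : P} {k l : ℕ} (hp : Γ.IsNest α k (ψ p)) (hq : Γ.IsNest α l (ψ q))
    (hlk : l < k) : ¬ p ≤ q := fun hpq => by
  have h1 := hp.2.2.1
  have h2 := hq.2.2.1
  rw [h.eq_of_le hp hq hlk.le hpq] at h1
  omega

lemma strictMono : StrictMono fun p => colorDim α (ψ p) := by
  intro p q hpq
  obtain ⟨k, -, hk⟩ := h.exists_isNest p
  obtain ⟨l, -, hl⟩ := h.exists_isNest q
  change colorDim α (ψ p) < colorDim α (ψ q)
  rw [hk.2.2.1, hl.2.2.1]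
  by_contra hlk
  exact hpq.ne (h.eq_of_le hk hl (not_lt.mp hlk) hpq.le)

/-- Two elements of equal rank are comparable only if they are equal. -/
lemma comparable_iff_eq {p q : P} {k : ℕ} (hp : Γ.IsNest α k (ψ p)) (hq : Γ.IsNest α k (ψ q)) :
    Comparable p q ↔ p = q :=
  ⟨fun hpq => hpq.elim (h.eq_of_le hp hq le_rfl) fun hqp => (h.eq_of_le hq hp le_rfl hqp).symm,
    fun e => Or.inl e.le⟩

lemma comparable_iff_le {p q : P} {k l : ℕ} (hp : Γ.IsNest α k (ψ p)) (hq : Γ.IsNest α l (ψ q))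
    (hkl : k < l) : Comparable p q ↔ p ≤ q :=
  ⟨fun hpq => hpq.resolve_right (h.not_le hq hp hkl), Or.inl⟩

variable (hα : Γ.IsColoring α)
include hα

lemma vertexSet_vtx {x : V} (hx : x ∈ V(Γ)) : V(ψ (vtx x)) = {x} :=
  (hα.vertexSet_edgeSet_of_isNest_zero (h.isNest_vtx x hx) (h.mem_vtx x hx)).1

lemma edgeSet_vtx {x : V} (hx : x ∈ V(Γ)) : E(ψ (vtx x)) = ∅ :=
  (hα.vertexSet_edgeSet_of_isNest_zero (h.isNest_vtx x hx) (h.mem_vtx x hx)).2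

lemma vertexSet_edg {e : E} (he : e ∈ E(Γ)) : V(ψ (edg e)) = {x | Γ.Inc e x} :=
  (hα.vertexSet_edgeSet_of_isNest_one (h.isNest_edg e he) (h.mem_edg e he)).1

lemma edgeSet_edg {e : E} (he : e ∈ E(Γ)) : E(ψ (edg e)) = {e} :=
  (hα.vertexSet_edgeSet_of_isNest_one (h.isNest_edg e he) (h.mem_edg e he)).2

lemma vtx_le_iff {x : V} (hx : x ∈ V(Γ)) (p : P) : vtx x ≤ p ↔ x ∈ V(ψ p) := by
  rw [h.le_iff]
  constructor
  · intro hle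
    exact hle.vertexSet_mono (h.mem_vtx x hx)
  · intro hxp
    refine ⟨?_, fun e a b hl => ?_⟩
    · rw [h.vertexSet_vtx hα hx]
      exact singleton_subset_iff.mpr hxp
    · exact absurd hl.edge_mem (by rw [h.edgeSet_vtx hα hx]; exact notMem_empty e)

lemma edg_le_iff {e : E} (he : e ∈ E(Γ)) (p : P) : edg e ≤ p ↔ e ∈ E(ψ p) := by
  rw [h.le_iff]
  constructor
  · intro hle
    exact hle.edgeSet_mono (h.mem_edg e he)
  · intro hep
    refine ⟨?_, fun g a b hl => ?_⟩
    · rw [h.vertexSet_edg hα he]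
      intro x hx
      exact ((IsSubgraph.inc_congr (h.le_graph p) hep).mpr hx).vertex_mem
    · have hg : g = e := by
        have := hl.edge_mem
        rwa [h.edgeSet_edg hα he] at this
      subst hg
      exact (IsSubgraph.isLink_iff (h.le_graph p) hep).mpr (hl.mono (h.le_graph _))

lemma vtx_inj {x y : V} (hx : x ∈ V(Γ)) (hy : y ∈ V(Γ)) : vtx x = vtx y ↔ x = y := by
  refine ⟨fun hxy => ?_, congrArg vtx⟩
  have := h.mem_vtx x hx
  rwa [hxy, h.vertexSet_vtx hα hy] at this

lemma edg_inj {e g : E} (he : e ∈ E(Γ)) (hg : g ∈ E(Γ)) : edg e = edg g ↔ e = g := by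
  refine ⟨fun heg => ?_, congrArg edg⟩
  have := h.mem_edg e he
  rwa [heg, h.edgeSet_edg hα hg] at this

lemma eq_vtx_or_eq_edg_or_isNest_two (p : P) :
    (∃ x ∈ V(Γ), p = vtx x) ∨ (∃ e ∈ E(Γ), p = edg e) ∨ Γ.IsNest α 2 (ψ p) := by
  obtain ⟨d, hd2, hd⟩ := h.exists_isNest p
  have hle := h.le_graph p
  interval_cases d
  · obtain ⟨x, hx⟩ := hd.2.1.1
    have hxΓ := hle.vertexSet_mono hx
    exact Or.inl ⟨x, hxΓ, (h.eq_of_le (h.isNest_vtx x hxΓ) hd le_rfl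
      ((h.vtx_le_iff hα hxΓ p).mpr hx)).symm⟩
  · obtain ⟨e, he⟩ := hd.edgeSet_nonempty one_ne_zero
    have heΓ := hle.edgeSet_mono he
    exact Or.inr (Or.inl ⟨e, heΓ, (h.eq_of_le (h.isNest_edg e heΓ) hd le_rfl
      ((h.edg_le_iff hα heΓ p).mpr he)).symm⟩)
  · exact Or.inr (Or.inr hd)

lemma comparable_vtx_vtx {x y : V} (hx : x ∈ V(Γ)) (hy : y ∈ V(Γ)) :
    Comparable (vtx x) (vtx y) ↔ x = y := by
  rw [h.comparable_iff_eq (h.isNest_vtx x hx) (h.isNest_vtx y hy), h.vtx_inj hα hx hy]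

lemma comparable_edg_edg {e g : E} (he : e ∈ E(Γ)) (hg : g ∈ E(Γ)) :
    Comparable (edg e) (edg g) ↔ e = g := by
  rw [h.comparable_iff_eq (h.isNest_edg e he) (h.isNest_edg g hg), h.edg_inj hα he hg]

lemma comparable_vtx_edg {x : V} {e : E} (hx : x ∈ V(Γ)) (he : e ∈ E(Γ)) :
    Comparable (vtx x) (edg e) ↔ Γ.Inc e x := by
  rw [h.comparable_iff_le (h.isNest_vtx x hx) (h.isNest_edg e he) (by omega),
    h.vtx_le_iff hα hx, h.vertexSet_edg hα he]
  rfl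

lemma comparable_vtx_face {x : V} {p : P} (hx : x ∈ V(Γ)) (hp : Γ.IsNest α 2 (ψ p)) :
    Comparable (vtx x) p ↔ x ∈ V(ψ p) := by
  rw [h.comparable_iff_le (h.isNest_vtx x hx) hp (by omega), h.vtx_le_iff hα hx]

lemma comparable_edg_face {e : E} {p : P} (he : e ∈ E(Γ)) (hp : Γ.IsNest α 2 (ψ p)) :
    Comparable (edg e) p ↔ e ∈ E(ψ p) := by
  rw [h.comparable_iff_le (h.isNest_edg e he) hp (by omega), h.edg_le_iff hα he]

end

end IsNestPoset

end Graph

/-! ### Boundaries of edges and faces -/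

namespace Graph

variable {V E : Type*} {n : ℕ}

lemma IsColoring.mem_edgeSet_face {Γ : Graph V E} {α : E → ColorSpace n} (hα : Γ.IsColoring α)
    {x : V} {g g' e : E} (hg : Γ.Inc g x) (hg' : Γ.Inc g' x) (he : Γ.Inc e x) :
    e ∈ E(Γ.face α x g g') ↔ e = g ∨ e = g' := by
  rw [← hα.face_inc_self hg hg']
  exact ⟨fun h => (IsSubgraph.inc_congr (colorComponent_le hg.vertex_mem) h).mpr he, Inc.edge_mem⟩

namespace IsNestPoset

variable {P : Type*} [PartialOrder P] {Γ : Graph V E} {α : E → ColorSpace n}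
  {ψ : P → Graph V E} {vtx : V → P} {edg : E → P} (h : IsNestPoset Γ α ψ vtx edg)

section

include h

lemma Iio_vtx {x : V} (hx : x ∈ V(Γ)) : Iio (vtx x) = ∅ := by
  refine eq_empty_of_forall_notMem fun p hp => ?_
  have h1 : colorDim α (ψ p) < colorDim α (ψ (vtx x)) := h.strictMono hp
  rw [(h.isNest_vtx x hx).2.2.1] at h1
  omega

lemma vtx_ne_edg {x : V} {e : E} (hx : x ∈ V(Γ)) (he : e ∈ E(Γ)) : vtx x ≠ edg e := fun heq =>
  h.not_le (h.isNest_edg e he) (h.isNest_vtx x hx) one_pos heq.ge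

lemma vtx_ne_face {x : V} {p : P} (hx : x ∈ V(Γ)) (hp : Γ.IsNest α 2 (ψ p)) : vtx x ≠ p :=
  fun heq => h.not_le hp (h.isNest_vtx x hx) two_pos heq.ge

lemma edg_ne_face {e : E} {p : P} (he : e ∈ E(Γ)) (hp : Γ.IsNest α 2 (ψ p)) : edg e ≠ p :=
  fun heq => h.not_le hp (h.isNest_edg e he) one_lt_two heq.ge

variable (hα : Γ.IsColoring α)
include hα

lemma lt_edg_iff {e : E} (he : e ∈ E(Γ)) {p : P} :
    p < edg e ↔ ∃ x, Γ.Inc e x ∧ p = vtx x := by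
  constructor
  · intro hp
    rcases h.eq_vtx_or_eq_edg_or_isNest_two hα p with ⟨x, hx, rfl⟩ | ⟨g, hg, rfl⟩ | hp2
    · exact ⟨x, (h.comparable_vtx_edg hα hx he).mp (Or.inl hp.le), rfl⟩
    · exact absurd (h.eq_of_le (h.isNest_edg g hg) (h.isNest_edg e he) le_rfl hp.le) hp.ne
    · exact absurd hp.le (h.not_le hp2 (h.isNest_edg e he) (by omega))
  · rintro ⟨x, hx, rfl⟩
    refine lt_of_le_not_ge ?_ (h.not_le (h.isNest_edg e he) (h.isNest_vtx x hx.vertex_mem) one_pos)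
    rw [h.vtx_le_iff hα hx.vertex_mem, h.vertexSet_edg hα he]
    exact hx

lemma lt_face_iff {p q : P} (hp : Γ.IsNest α 2 (ψ p)) :
    q < p ↔ (∃ x ∈ V(ψ p), q = vtx x) ∨ ∃ e ∈ E(ψ p), q = edg e := by
  have hle := h.le_graph p
  constructor
  · intro hq
    rcases h.eq_vtx_or_eq_edg_or_isNest_two hα q with ⟨x, hx, rfl⟩ | ⟨g, hg, rfl⟩ | hq2
    · exact Or.inl ⟨x, (h.vtx_le_iff hα hx p).mp hq.le, rfl⟩
    · exact Or.inr ⟨g, (h.edg_le_iff hα hg p).mp hq.le, rfl⟩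
    · exact absurd (h.eq_of_le hq2 hp le_rfl hq.le) hq.ne
  · rintro (⟨x, hx, rfl⟩ | ⟨e, he, rfl⟩)
    · have hxΓ := hle.vertexSet_mono hx
      exact lt_of_le_not_ge ((h.vtx_le_iff hα hxΓ p).mpr hx)
        (h.not_le hp (h.isNest_vtx x hxΓ) (by omega))
    · have heΓ := hle.edgeSet_mono he
      exact lt_of_le_not_ge ((h.edg_le_iff hα heΓ p).mpr he)
        (h.not_le hp (h.isNest_edg e heΓ) (by omega))

end

variable [Fintype P]

include h in
lemma isEuclideanCone_Iio_edg (hα : Γ.IsColoring α) {e : E} (he : e ∈ E(Γ)) :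
    IsEuclideanCone 1 Comparable (Iio (edg e)) := by
  obtain ⟨x, y, hxy⟩ := exists_isLink_of_mem_edgeSet he
  have hset : Iio (edg e) = {vtx x, vtx y} := by
    ext p
    rw [mem_Iio, h.lt_edg_iff hα he]
    constructor
    · rintro ⟨z, hz, rfl⟩
      rcases hz.eq_or_eq_of_isLink hxy with rfl | rfl <;> simp
    · rintro (rfl | rfl)
      · exact ⟨x, hxy.inc_left, rfl⟩
      · exact ⟨y, hxy.inc_right, rfl⟩
  have hne := hα.ne hxy
  rw [hset]
  refine isEuclideanCone_one ?_ ?_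
  · rwa [Ne, h.vtx_inj hα hxy.left_mem hxy.right_mem]
  · rwa [h.comparable_vtx_vtx hα hxy.left_mem hxy.right_mem]

include h in
/-- The boundary of a face is a cycle, whose members are alternately vertices and edges. -/
lemma isEuclideanCone_Iio_face (hα : Γ.IsGoodColoring α) {p : P} (hp : Γ.IsNest α 2 (ψ p)) :
    IsEuclideanCone 2 Comparable (Iio p) := by
  have hle := h.le_graph p
  have hvlt : ∀ x ∈ V(ψ p), vtx x < p := fun x hx =>
    (h.lt_face_iff hα.1 hp).mpr (Or.inl ⟨x, hx, rfl⟩)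
  have helt : ∀ e ∈ E(ψ p), edg e < p := fun e he =>
    (h.lt_face_iff hα.1 hp).mpr (Or.inr ⟨e, he, rfl⟩)
  have hve : ∀ x ∈ V(ψ p), ∀ e ∈ E(ψ p), Comparable (vtx x) (edg e) ↔ (ψ p).Inc e x :=
    fun x hx e he => by
      rw [h.comparable_vtx_edg hα.1 (hle.vertexSet_mono hx) (hle.edgeSet_mono he),
        IsSubgraph.inc_congr hle he]
  have hvv : ∀ x ∈ V(ψ p), ∀ y ∈ V(ψ p), Comparable (vtx x) (vtx y) ↔ x = y := fun x hx y hy =>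
    h.comparable_vtx_vtx hα.1 (hle.vertexSet_mono hx) (hle.vertexSet_mono hy)
  have hee : ∀ x ∈ E(ψ p), ∀ y ∈ E(ψ p), Comparable (edg x) (edg y) ↔ x = y := fun x hx y hy =>
    h.comparable_edg_edg hα.1 (hle.edgeSet_mono hx) (hle.edgeSet_mono hy)
  have hvi : ∀ x ∈ V(ψ p), ∀ y ∈ V(ψ p), vtx x = vtx y ↔ x = y := fun x hx y hy =>
    h.vtx_inj hα.1 (hle.vertexSet_mono hx) (hle.vertexSet_mono hy)
  have hei : ∀ x ∈ E(ψ p), ∀ y ∈ E(ψ p), edg x = edg y ↔ x = y := fun x hx y hy =>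
    h.edg_inj hα.1 (hle.edgeSet_mono hx) (hle.edgeSet_mono hy)
  have hvne : ∀ x ∈ V(ψ p), ∀ e ∈ E(ψ p), vtx x ≠ edg e := fun x hx e he =>
    h.vtx_ne_edg (hle.vertexSet_mono hx) (hle.edgeSet_mono he)
  obtain ⟨e₀, he₀⟩ := hp.edgeSet_nonempty two_ne_zero
  obtain ⟨x₀, y₀, hxy₀⟩ := exists_isLink_of_mem_edgeSet he₀
  have hne₀ := hα.1.ne (hxy₀.mono hle)
  have hcyc : ∃ (m : ℕ) (a : ℕ → P), BijOn a (Iio m) (Iio p) ∧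
      ∀ i < m, ∀ j < m, i ≠ j → (Comparable (a i) (a j) ↔ CycAdj m i j) := by
    refine exists_cyclic_enumeration (toFinite _) ⟨edg e₀, helt e₀ he₀⟩
      (fun _ _ hc => Or.symm hc) ?_ ?_
    · intro q hq
      rcases (h.lt_face_iff hα.1 hp).mp hq with ⟨x, hx, rfl⟩ | ⟨e, he, rfl⟩
      · obtain ⟨g, g', hne, hinc⟩ := hα.exists_inc_iff_of_isNest_two hp hx
        have hg := ((hinc g).mpr (Or.inl rfl)).edge_mem
        have hg' := ((hinc g').mpr (Or.inr rfl)).edge_mem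
        refine ⟨edg g, helt g hg, edg g', helt g' hg', by rwa [Ne, hei g hg g' hg'], fun w hw => ?_⟩
        rcases (h.lt_face_iff hα.1 hp).mp hw with ⟨y, hy, rfl⟩ | ⟨e, he, rfl⟩
        · rw [Ne, hvi x hx y hy, hvv x hx y hy]
          exact ⟨fun hxy => absurd hxy.2 hxy.1,
            fun h' => h'.elim (fun h' => absurd h' (hvne y hy g hg))
              fun h' => absurd h' (hvne y hy g' hg')⟩
        · rw [hve x hx e he, hinc, hei e he g hg, hei e he g' hg']
          exact ⟨And.right, fun h' => ⟨hvne x hx e he, h'⟩⟩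
      · obtain ⟨x, y, hxy⟩ := exists_isLink_of_mem_edgeSet he
        have hx := hxy.left_mem
        have hy := hxy.right_mem
        refine ⟨vtx x, hvlt x hx, vtx y, hvlt y hy, ?_, fun w hw => ?_⟩
        · rw [Ne, hvi x hx y hy]
          exact hα.1.ne (hxy.mono hle)
        rcases (h.lt_face_iff hα.1 hp).mp hw with ⟨z, hz, rfl⟩ | ⟨g, hg, rfl⟩
        · rw [comparable_comm, hve z hz e he, hvi z hz x hx, hvi z hz y hy]
          constructor
          · exact fun h' => h'.2.eq_or_eq_of_isLink hxy
          · rintro (rfl | rfl)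
            · exact ⟨(hvne _ hz e he).symm, hxy.inc_left⟩
            · exact ⟨(hvne _ hz e he).symm, hxy.inc_right⟩
        · rw [Ne, hei e he g hg, hee e he g hg]
          exact ⟨fun h' => absurd h'.2 h'.1,
            fun h' => h'.elim (fun h' => absurd h'.symm (hvne x hx g hg))
              fun h' => absurd h'.symm (hvne y hy g hg)⟩
    · intro S hS ⟨s, hs⟩ hclosed
      have hstep : ∀ e x y, (ψ p).IsLink e x y → vtx x ∈ S → edg e ∈ S ∧ vtx y ∈ S := by
        intro e x y hxy hx
        have he := hclosed _ hx (edg e) (helt e hxy.edge_mem)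
          ((hve x hxy.left_mem e hxy.edge_mem).mpr hxy.inc_left)
        exact ⟨he, hclosed _ he (vtx y) (hvlt y hxy.right_mem)
          (Or.symm ((hve y hxy.right_mem e hxy.edge_mem).mpr hxy.inc_right))⟩
      obtain ⟨x, hx, hxS⟩ : ∃ x ∈ V(ψ p), vtx x ∈ S := by
        rcases (h.lt_face_iff hα.1 hp).mp (hS hs) with ⟨x, hx, rfl⟩ | ⟨e, he, rfl⟩
        · exact ⟨x, hx, hs⟩
        · obtain ⟨x, y, hxy⟩ := exists_isLink_of_mem_edgeSet he
          exact ⟨x, hxy.left_mem, hclosed _ hs _ (hvlt x hxy.left_mem)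
            (Or.symm ((hve x hxy.left_mem e he).mpr hxy.inc_left))⟩
      have hall : ∀ y ∈ V(ψ p), vtx y ∈ S := by
        intro y hy
        have := hp.2.1.2 x hx y hy
        induction this with
        | refl => exact hxS
        | tail _ hbc ih =>
          obtain ⟨e, he⟩ := hbc
          exact (hstep e _ _ he (ih he.left_mem)).2
      refine Subset.antisymm hS fun q hq => ?_
      rcases (h.lt_face_iff hα.1 hp).mp hq with ⟨y, hy, rfl⟩ | ⟨e, he, rfl⟩
      · exact hall y hy
      · obtain ⟨y, z, hyz⟩ := exists_isLink_of_mem_edgeSet he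
        exact (hstep e y z hyz (hall y hyz.left_mem)).1
  obtain ⟨m, a, ha, hR⟩ := hcyc
  refine isEuclideanCone_two ?_ ha hR
  -- In a cycle of length at most three any two members are adjacent, but two vertices are not.
  by_contra hm
  obtain ⟨i, hi, hix⟩ := ha.surjOn (hvlt x₀ hxy₀.left_mem)
  obtain ⟨j, hj, hjy⟩ := ha.surjOn (hvlt y₀ hxy₀.right_mem)
  rw [mem_Iio] at hi hj
  have hij : i ≠ j := by
    rintro rfl
    exact hne₀ ((hvi _ hxy₀.left_mem _ hxy₀.right_mem).mp (hix.symm.trans hjy))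
  have hadj : CycAdj m i j := by
    unfold CycAdj
    omega
  rw [← hR i hi j hj hij, hix, hjy, hvv _ hxy₀.left_mem _ hxy₀.right_mem] at hadj
  exact hne₀ hadj

end IsNestPoset

end Graph

/-! ### Links in the poset of nests -/

namespace Graph

variable {V E : Type*} {n : ℕ}

/-- In a `3`-valent graph with a coloring, every edge at a vertex comes with two further edges. -/
lemma IsColoring.exists_inc_iff_of_inc {Γ : Graph V E} {α : E → ColorSpace n}
    (hα : Γ.IsColoring α) (hreg : Γ.IsRegularOfValence 3) {x : V} {e : E} (he : Γ.Inc e x) :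
    ∃ g g', e ≠ g ∧ e ≠ g' ∧ g ≠ g' ∧ ∀ k, Γ.Inc k x ↔ k = e ∨ k = g ∨ k = g' := by
  obtain ⟨e₀, e₁, e₂, h01, h02, h12, hinc⟩ := hα.exists_inc_iff hreg he.vertex_mem
  rcases (hinc e).mp he with rfl | rfl | rfl
  · exact ⟨e₁, e₂, h01, h02, h12, hinc⟩
  · exact ⟨e₀, e₂, h01.symm, h12, h02, fun k => by rw [hinc]; tauto⟩
  · exact ⟨e₀, e₁, h02.symm, h12.symm, h01, fun k => by rw [hinc]; tauto⟩

/-- Exactly two nests of dimension `2` contain a given edge: they belong to the two corners that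
the edge spans with the other edges at one of its ends. -/
lemma IsGoodColoring.exists_isNest_two_iff {Γ : Graph V E} {α : E → ColorSpace n}
    (hα : Γ.IsGoodColoring α) (hreg : Γ.IsRegularOfValence 3) {e : E} (he : e ∈ E(Γ)) :
    ∃ Δ Δ', Δ ≠ Δ' ∧ ∀ Θ, Γ.IsNest α 2 Θ ∧ e ∈ E(Θ) ↔ Θ = Δ ∨ Θ = Δ' := by
  obtain ⟨x, y, hxy⟩ := exists_isLink_of_mem_edgeSet he
  have hex := hxy.inc_left
  obtain ⟨g, g', heg, heg', hgg', hinc⟩ := hα.1.exists_inc_iff_of_inc hreg hex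
  have hg : Γ.Inc g x := (hinc g).mpr (by simp)
  have hg' : Γ.Inc g' x := (hinc g').mpr (by simp)
  refine ⟨Γ.face α x e g, Γ.face α x e g', fun heq => ?_, fun Θ => ⟨?_, ?_⟩⟩
  · have h1 : g ∈ E(Γ.face α x e g) := (hα.1.mem_edgeSet_face hex hg hg).mpr (Or.inr rfl)
    rw [heq, hα.1.mem_edgeSet_face hex hg' hg] at h1
    rcases h1 with h1 | h1
    · exact heg h1.symm
    · exact hgg' h1
  · rintro ⟨hΘ, heΘ⟩
    have hx := ((IsSubgraph.inc_congr hΘ.1.le heΘ).mpr hex).vertex_mem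
    obtain ⟨k, k', hne, hk, hk', rfl⟩ := hα.exists_eq_face hΘ hx
    rw [hα.1.mem_edgeSet_face hk hk' hex] at heΘ
    rw [hinc] at hk hk'
    rcases heΘ with rfl | rfl
    · rcases hk' with rfl | rfl | rfl
      · exact absurd rfl hne
      · exact Or.inl rfl
      · exact Or.inr rfl
    · rw [face_comm x k e]
      rcases hk with rfl | rfl | rfl
      · exact absurd rfl hne
      · exact Or.inl rfl
      · exact Or.inr rfl
  · rintro (rfl | rfl)
    · exact ⟨hα.1.isNest_face heg hex hg hg' heg'.symm hgg'.symm,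
        (hα.1.mem_edgeSet_face hex hg hex).mpr (Or.inl rfl)⟩
    · exact ⟨hα.1.isNest_face heg' hex hg' hg heg.symm hgg',
        (hα.1.mem_edgeSet_face hex hg' hex).mpr (Or.inl rfl)⟩

namespace IsNestPoset

variable {P : Type*} [PartialOrder P] {Γ : Graph V E} {α : E → ColorSpace n}
  {ψ : P → Graph V E} {vtx : V → P} {edg : E → P} (h : IsNestPoset Γ α ψ vtx edg)
  (hα : Γ.IsGoodColoring α) (hreg : Γ.IsRegularOfValence 3)

section

variable [Fintype P]

include h hα in
lemma isEuclideanCone_link_face {p : P} (hp : Γ.IsNest α 2 (ψ p)) :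
    IsEuclideanCone 2 Comparable {q | q ≠ p ∧ Comparable p q} := by
  convert! h.isEuclideanCone_Iio_face hα hp using 1
  ext q
  obtain ⟨k, hk2, hk⟩ := h.exists_isNest q
  constructor
  · rintro ⟨hne, hle | hle⟩
    · exact absurd (h.eq_of_le hp hk hk2 hle).symm hne
    · exact lt_of_le_of_ne hle hne
  · intro hq
    exact ⟨hq.ne, Or.inr hq.le⟩

include h hα hreg in
/-- The link of an edge is a square: its ends alternate with its two faces. -/
lemma isEuclideanCone_link_edg {e : E} (he : e ∈ E(Γ)) :
    IsEuclideanCone 2 Comparable {q | q ≠ edg e ∧ Comparable (edg e) q} := by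
  obtain ⟨x, y, hxy⟩ := exists_isLink_of_mem_edgeSet he
  obtain ⟨Δ, Δ', hne, hΔ⟩ := hα.exists_isNest_two_iff hreg he
  obtain ⟨hp, hep⟩ := (hΔ Δ).mpr (Or.inl rfl)
  obtain ⟨hq, heq⟩ := (hΔ Δ').mpr (Or.inr rfl)
  obtain ⟨p, rfl⟩ := h.exists_eq Δ hp
  obtain ⟨q, rfl⟩ := h.exists_eq Δ' hq
  have hpq : p ≠ q := fun hpq => hne (congrArg ψ hpq)
  have hx := hxy.left_mem
  have hy := hxy.right_mem
  have hxp := ((IsSubgraph.inc_congr hp.1.le hep).mpr hxy.inc_left).vertex_mem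
  have hyp := ((IsSubgraph.inc_congr hp.1.le hep).mpr hxy.inc_right).vertex_mem
  have hxq := ((IsSubgraph.inc_congr hq.1.le heq).mpr hxy.inc_left).vertex_mem
  have hyq := ((IsSubgraph.inc_congr hq.1.le heq).mpr hxy.inc_right).vertex_mem
  have c02 : ¬ Comparable (vtx x) (vtx y) := by
    rw [h.comparable_vtx_vtx hα.1 hx hy]
    exact hα.1.ne hxy
  have c13 : ¬ Comparable p q := by rwa [h.comparable_iff_eq hp hq]
  have c01 : Comparable (vtx x) p := (h.comparable_vtx_face hα.1 hx hp).mpr hxp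
  have c21 : Comparable (vtx y) p := (h.comparable_vtx_face hα.1 hy hp).mpr hyp
  have c03 : Comparable (vtx x) q := (h.comparable_vtx_face hα.1 hx hq).mpr hxq
  have c23 : Comparable (vtx y) q := (h.comparable_vtx_face hα.1 hy hq).mpr hyq
  have n02 : vtx x ≠ vtx y := fun e => c02 (Or.inl e.le)
  have n01 := h.vtx_ne_face hx hp
  have n21 := h.vtx_ne_face hy hp
  have n03 := h.vtx_ne_face hx hq
  have n23 := h.vtx_ne_face hy hq
  let a : ℕ → P := fun i => match i with
    | 0 => vtx x
    | 1 => p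
    | 2 => vtx y
    | _ => q
  refine isEuclideanCone_two (m := 4) (a := a) le_rfl ⟨?_, ?_, ?_⟩ ?_
  · intro i hi
    have ce : ∀ z, Γ.Inc e z → vtx z ≠ edg e ∧ Comparable (edg e) (vtx z) := fun z hz =>
      ⟨h.vtx_ne_edg hz.vertex_mem he,
        Or.symm ((h.comparable_vtx_edg hα.1 hz.vertex_mem he).mpr hz)⟩
    rw [mem_Iio] at hi
    interval_cases i
    · exact ce x hxy.inc_left
    · exact ⟨(h.edg_ne_face he hp).symm, (h.comparable_edg_face hα.1 he hp).mpr hep⟩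
    · exact ce y hxy.inc_right
    · exact ⟨(h.edg_ne_face he hq).symm, (h.comparable_edg_face hα.1 he hq).mpr heq⟩
  · intro i hi j hj hij
    rw [mem_Iio] at hi hj
    interval_cases i <;> interval_cases j <;> simp only [a] at hij <;> grind
  · rintro s ⟨hse, hs⟩
    rcases h.eq_vtx_or_eq_edg_or_isNest_two hα.1 s with ⟨z, hz, rfl⟩ | ⟨g, hg, rfl⟩ | hs2
    · rw [comparable_comm, h.comparable_vtx_edg hα.1 hz he] at hs
      rcases hs.eq_or_eq_of_isLink hxy with rfl | rfl
      · exact ⟨0, by simp, rfl⟩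
      · exact ⟨2, by simp, rfl⟩
    · rw [h.comparable_edg_edg hα.1 he hg] at hs
      exact absurd (congrArg edg hs).symm hse
    · rw [h.comparable_edg_face hα.1 he hs2] at hs
      rcases (hΔ (ψ s)).mp ⟨hs2, hs⟩ with hs | hs
      · exact ⟨1, by simp, (h.injective hs).symm⟩
      · exact ⟨3, by simp, (h.injective hs).symm⟩
  · intro i hi j hj hij
    interval_cases i <;> interval_cases j <;>
      simp [a, CycAdj, c02, c13, c01, c21, c03, c23, comparable_comm (p := p),
        comparable_comm (p := q), comparable_comm (p := vtx y) (q := vtx x)] at hij ⊢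

include h hα hreg in
/-- The link of a vertex is a hexagon: its three edges alternate with its three corners. -/
lemma isEuclideanCone_link_vtx {x : V} (hx : x ∈ V(Γ)) :
    IsEuclideanCone 2 Comparable {q | q ≠ vtx x ∧ Comparable (vtx x) q} := by
  obtain ⟨e₀, e₁, e₂, h01, h02, h12, hinc⟩ := hα.1.exists_inc_iff hreg hx
  have i0 : Γ.Inc e₀ x := (hinc e₀).mpr (by simp)
  have i1 : Γ.Inc e₁ x := (hinc e₁).mpr (by simp)
  have i2 : Γ.Inc e₂ x := (hinc e₂).mpr (by simp)
  have n01 := hα.1.isNest_face h01 i0 i1 i2 h02.symm h12.symm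
  have n12 := hα.1.isNest_face h12 i1 i2 i0 h01 h02
  have n02 := hα.1.isNest_face h02 i0 i2 i1 h01.symm h12
  obtain ⟨p, hp⟩ := h.exists_eq _ n01
  obtain ⟨q, hq⟩ := h.exists_eq _ n12
  obtain ⟨r, hr⟩ := h.exists_eq _ n02
  have hpE : ∀ e, Γ.Inc e x → (e ∈ E(ψ p) ↔ e = e₀ ∨ e = e₁) := fun e he =>
    hp ▸ hα.1.mem_edgeSet_face i0 i1 he
  have hqE : ∀ e, Γ.Inc e x → (e ∈ E(ψ q) ↔ e = e₁ ∨ e = e₂) := fun e he =>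
    hq ▸ hα.1.mem_edgeSet_face i1 i2 he
  have hrE : ∀ e, Γ.Inc e x → (e ∈ E(ψ r) ↔ e = e₀ ∨ e = e₂) := fun e he =>
    hr ▸ hα.1.mem_edgeSet_face i0 i2 he
  have hxp : x ∈ V(ψ p) := hp ▸ self_mem_face
  have hxq : x ∈ V(ψ q) := hq ▸ self_mem_face
  have hxr : x ∈ V(ψ r) := hr ▸ self_mem_face
  have cf : ∀ s, Γ.IsNest α 2 (ψ s) → x ∈ V(ψ s) → s = p ∨ s = q ∨ s = r := by
    intro s hs hxs
    obtain ⟨k, k', hne, hk, hk', heq⟩ := hα.exists_eq_face hs hxs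
    rw [hinc] at hk hk'
    have key : ψ s = ψ p ∨ ψ s = ψ q ∨ ψ s = ψ r := by
      rw [heq, hp, hq, hr]
      rcases hk with rfl | rfl | rfl <;> rcases hk' with rfl | rfl | rfl <;>
        simp [face_comm] at hne ⊢
    exact key.imp (fun e => h.injective e) (Or.imp (fun e => h.injective e) fun e => h.injective e)
  rw [← hp] at n01
  rw [← hq] at n12
  rw [← hr] at n02
  have hpq : ¬ Comparable p q := by
    rw [h.comparable_iff_eq n01 n12]
    rintro rfl
    have := (hpE e₀ i0).symm.trans (hqE e₀ i0)
    grind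
  have hpr : ¬ Comparable p r := by
    rw [h.comparable_iff_eq n01 n02]
    rintro rfl
    have := (hpE e₁ i1).symm.trans (hrE e₁ i1)
    grind
  have hqr : ¬ Comparable q r := by
    rw [h.comparable_iff_eq n12 n02]
    rintro rfl
    have := (hqE e₀ i0).symm.trans (hrE e₀ i0)
    grind
  have cee : ∀ e g, Γ.Inc e x → Γ.Inc g x → (Comparable (edg e) (edg g) ↔ e = g) :=
    fun e g he hg => h.comparable_edg_edg hα.1 he.edge_mem hg.edge_mem
  have cep : ∀ e, Γ.Inc e x → (Comparable (edg e) p ↔ e = e₀ ∨ e = e₁) := fun e he => by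
    rw [h.comparable_edg_face hα.1 he.edge_mem n01, hpE e he]
  have ceq : ∀ e, Γ.Inc e x → (Comparable (edg e) q ↔ e = e₁ ∨ e = e₂) := fun e he => by
    rw [h.comparable_edg_face hα.1 he.edge_mem n12, hqE e he]
  have cer : ∀ e, Γ.Inc e x → (Comparable (edg e) r ↔ e = e₀ ∨ e = e₂) := fun e he => by
    rw [h.comparable_edg_face hα.1 he.edge_mem n02, hrE e he]
  let a : ℕ → P := fun i => match i with
    | 0 => edg e₀
    | 1 => p
    | 2 => edg e₁
    | 3 => q
    | 4 => edg e₂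
    | _ => r
  refine isEuclideanCone_two (m := 6) (a := a) (by omega) ⟨?_, ?_, ?_⟩ ?_
  · intro i hi
    have ce : ∀ e, Γ.Inc e x → edg e ≠ vtx x ∧ Comparable (vtx x) (edg e) := fun e he =>
      ⟨(h.vtx_ne_edg hx he.edge_mem).symm, (h.comparable_vtx_edg hα.1 hx he.edge_mem).mpr he⟩
    have cf' : ∀ s, Γ.IsNest α 2 (ψ s) → x ∈ V(ψ s) → s ≠ vtx x ∧ Comparable (vtx x) s :=
      fun s hs hxs => ⟨(h.vtx_ne_face hx hs).symm, (h.comparable_vtx_face hα.1 hx hs).mpr hxs⟩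
    rw [mem_Iio] at hi
    interval_cases i
    · exact ce e₀ i0
    · exact cf' p n01 hxp
    · exact ce e₁ i1
    · exact cf' q n12 hxq
    · exact ce e₂ i2
    · exact cf' r n02 hxr
  · have d01 : edg e₀ ≠ edg e₁ := by rwa [Ne, h.edg_inj hα.1 i0.edge_mem i1.edge_mem]
    have d02 : edg e₀ ≠ edg e₂ := by rwa [Ne, h.edg_inj hα.1 i0.edge_mem i2.edge_mem]
    have d12 : edg e₁ ≠ edg e₂ := by rwa [Ne, h.edg_inj hα.1 i1.edge_mem i2.edge_mem]
    have dpq : p ≠ q := fun e => hpq (Or.inl e.le)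
    have dpr : p ≠ r := fun e => hpr (Or.inl e.le)
    have dqr : q ≠ r := fun e => hqr (Or.inl e.le)
    have df : ∀ e s, Γ.Inc e x → Γ.IsNest α 2 (ψ s) → edg e ≠ s := fun e s he hs =>
      h.edg_ne_face he.edge_mem hs
    have := df e₀ p i0 n01
    have := df e₀ q i0 n12
    have := df e₀ r i0 n02
    have := df e₁ p i1 n01
    have := df e₁ q i1 n12
    have := df e₁ r i1 n02
    have := df e₂ p i2 n01
    have := df e₂ q i2 n12
    have := df e₂ r i2 n02
    clear cee cep ceq cer cf hpE hqE hrE hinc df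
    intro i hi j hj hij
    rw [mem_Iio] at hi hj
    interval_cases i <;> interval_cases j <;> simp only [a] at hij <;> first | rfl | contradiction |
      exact absurd hij.symm (by assumption)
  · rintro s ⟨hsx, hs⟩
    rcases h.eq_vtx_or_eq_edg_or_isNest_two hα.1 s with ⟨z, hz, rfl⟩ | ⟨g, hg, rfl⟩ | hs2
    · rw [h.comparable_vtx_vtx hα.1 hx hz] at hs
      exact absurd (congrArg vtx hs).symm hsx
    · rw [h.comparable_vtx_edg hα.1 hx hg, hinc] at hs
      rcases hs with rfl | rfl | rfl
      · exact ⟨0, by simp, rfl⟩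
      · exact ⟨2, by simp, rfl⟩
      · exact ⟨4, by simp, rfl⟩
    · rw [h.comparable_vtx_face hα.1 hx hs2] at hs
      rcases cf s hs2 hs with rfl | rfl | rfl
      · exact ⟨1, by simp, rfl⟩
      · exact ⟨3, by simp, rfl⟩
      · exact ⟨5, by simp, rfl⟩
  · intro i hi j hj hij
    have cpe : ∀ e, Γ.Inc e x → (Comparable p (edg e) ↔ e = e₀ ∨ e = e₁) := fun e he => by
      rw [comparable_comm, cep e he]
    have cqe : ∀ e, Γ.Inc e x → (Comparable q (edg e) ↔ e = e₁ ∨ e = e₂) := fun e he => by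
      rw [comparable_comm, ceq e he]
    have cre : ∀ e, Γ.Inc e x → (Comparable r (edg e) ↔ e = e₀ ∨ e = e₂) := fun e he => by
      rw [comparable_comm, cer e he]
    have hqp := mt comparable_comm.mp hpq
    have hrp := mt comparable_comm.mp hpr
    have hrq := mt comparable_comm.mp hqr
    interval_cases i <;> interval_cases j <;>
      simp [a, CycAdj, hpq, hpr, hqr, hqp, hrp, hrq, cee, cep, ceq, cer, cpe, cqe, cre, i0, i1, i2,
        h01, h02, h12, h01.symm, h02.symm, h12.symm] at hij ⊢

end

include h hα in
lemma reflTransGen_comparable (hconn : Γ.IsConn) (p q : P) :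
    Relation.ReflTransGen Comparable p q := by
  have hvtx : ∀ p, ∃ x ∈ V(Γ), vtx x ≤ p := by
    intro p
    obtain ⟨k, -, hk⟩ := h.exists_isNest p
    obtain ⟨x, hx⟩ := hk.2.1.1
    have hxΓ := hk.1.le.vertexSet_mono hx
    exact ⟨x, hxΓ, (h.vtx_le_iff hα.1 hxΓ p).mpr hx⟩
  obtain ⟨x, hx, hxp⟩ := hvtx p
  obtain ⟨y, hy, hyq⟩ := hvtx q
  have hxy : Relation.ReflTransGen Comparable (vtx x) (vtx y) := by
    have := hconn.2 x hx y hy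
    clear hyq hy
    induction this with
    | refl => exact .refl
    | tail _ hbc ih =>
      obtain ⟨e, he⟩ := hbc
      have h1 := (h.comparable_vtx_edg hα.1 he.left_mem he.edge_mem).mpr he.inc_left
      have h2 := (h.comparable_vtx_edg hα.1 he.right_mem he.edge_mem).mpr he.inc_right
      exact (ih.tail h1).tail (Or.symm h2)
  exact (hxy.head (show Comparable p (vtx x) from Or.inr hxp)).tail (Or.inl hyq)

include h hα hreg in
theorem isSurfacePoset [Fintype P] (hconn : Γ.IsConn) :
    IsSurfacePoset fun p => colorDim α (ψ p) where
  nonempty := hconn.1.elim fun x _ => ⟨vtx x⟩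
  strictMono := h.strictMono
  cone_Iio p := by
    rcases h.eq_vtx_or_eq_edg_or_isNest_two hα.1 p with ⟨x, hx, rfl⟩ | ⟨e, he, rfl⟩ | hp
    · rw [(h.isNest_vtx x hx).2.2.1, h.Iio_vtx hx]
      exact isEuclideanCone_zero
    · rw [(h.isNest_edg e he).2.2.1]
      exact h.isEuclideanCone_Iio_edg hα.1 he
    · rw [hp.2.2.1]
      exact h.isEuclideanCone_Iio_face hα hp
  cone_link p := by
    rcases h.eq_vtx_or_eq_edg_or_isNest_two hα.1 p with ⟨x, hx, rfl⟩ | ⟨e, he, rfl⟩ | hp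
    · exact h.isEuclideanCone_link_vtx hα hreg hx
    · exact h.isEuclideanCone_link_edg hα hreg he
    · exact h.isEuclideanCone_link_face hα hp
  connected := h.reflTransGen_comparable hα hconn

end IsNestPoset

end Graph

/-! ### The skeletal expansion -/

namespace Graph

variable {V E : Type*} {n : ℕ} {Γ : Graph V E} {α : E → ColorSpace n}

lemma finite_nestSkeleton (hV : V(Γ).Finite) (hE : E(Γ).Finite) (k : ℕ) :
    Finite (Γ.NestSkeleton α k) := by
  have := hV.finite_subsets.to_subtype
  have := hE.finite_subsets.to_subtype
  have hle : ∀ Δ : Γ.NestSkeleton α k, Δ.1 ≤ Γ := fun Δ => Δ.2.elim fun d hd => hd.2.1.le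
  refine Finite.of_injective (fun Δ : Γ.NestSkeleton α k =>
    ((⟨V(Δ.1), (hle Δ).vertexSet_mono⟩, ⟨E(Δ.1), (hle Δ).edgeSet_mono⟩) :
      {s | s ⊆ V(Γ)} × {s | s ⊆ E(Γ)})) fun Δ Δ' heq => ?_
  simp only [Prod.mk.injEq, Subtype.mk.injEq] at heq
  exact Subtype.ext (Compatible.ext heq.1 heq.2 (Compatible.of_le_le (hle Δ) (hle Δ')))

lemma IsColoring.exists_isNest_zero (hα : Γ.IsColoring α) (hreg : Γ.IsRegularOfValence 3) {x : V}
    (hx : x ∈ V(Γ)) : ∃ Δ, Γ.IsNest α 0 Δ ∧ x ∈ V(Δ) := by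
  obtain ⟨e₀, e₁, e₂, -, -, -, hinc⟩ := hα.exists_inc_iff hreg hx
  have := hα.isNest_colorComponent hx finite_empty (fun e he => absurd he (notMem_empty e))
    ⟨e₀, (hinc e₀).mpr (Or.inl rfl), notMem_empty e₀⟩
  rw [ncard_empty] at this
  exact ⟨_, this, self_mem_colorComponent⟩

lemma IsColoring.exists_isNest_one (hα : Γ.IsColoring α) (hreg : Γ.IsRegularOfValence 3) {e : E}
    (he : e ∈ E(Γ)) : ∃ Δ, Γ.IsNest α 1 Δ ∧ e ∈ E(Δ) := by
  obtain ⟨x, y, hxy⟩ := exists_isLink_of_mem_edgeSet he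
  obtain ⟨g, g', heg, -, -, hinc⟩ := hα.exists_inc_iff_of_inc hreg hxy.inc_left
  have hS : ∀ k ∈ ({e} : Set E), Γ.Inc k x := by
    rintro _ rfl
    exact hxy.inc_left
  have := hα.isNest_colorComponent hxy.left_mem (finite_singleton e) hS
    ⟨g, (hinc g).mpr (by simp), by simpa using heg.symm⟩
  rw [ncard_singleton] at this
  exact ⟨_, this, ((hα.colorComponent_inc_self hS).mpr rfl).edge_mem⟩

end Graph

open Graph in
theorem theorem3p1 {V E : Type*} (Γ : Graph V E) (α : E → ColorSpace 2)
    (hV : V(Γ).Finite) (hE : E(Γ).Finite) (hconn : Γ.IsConn) (hreg : Γ.IsRegularOfValence 3)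
    (hgood : Γ.IsGoodColoring α) :
    ∃ (M : Type) (_ : TopologicalSpace M) (K : SkeletalExpansion Γ α 2 M),
      IsClosedSurface M ∧
      (∀ Δ : Graph V E, Γ.IsNest α 2 Δ → Δ.IsCircle) ∧
      (∀ f : K.Cell 2, K.boundary f =
        ⋃ (d : ℕ) (c : K.Cell d) (_ : K.nestOf c < K.nestOf f), K.openCell c) ∧
      (∀ e ∈ E(Γ), {f : K.Cell 2 | e ∈ E(K.nestOf f)}.encard = 2) := by
  have hα := hgood.1
  -- The nests, which may live in a higher universe, are indexed by a finite poset in `Type`.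
  obtain ⟨ι, hι, ⟨φ⟩⟩ : ∃ (ι : Type) (_ : Fintype ι), Nonempty (ι ≃ Γ.NestSkeleton α 2) := by
    have := finite_nestSkeleton (α := α) hV hE 2
    obtain ⟨N, ⟨φ⟩⟩ := Finite.exists_equiv_fin (Γ.NestSkeleton α 2)
    exact ⟨Fin N, inferInstance, ⟨φ.symm⟩⟩
  let ψ : ι → Graph V E := fun i => (φ i).1
  have hψ : Function.Injective ψ := Subtype.val_injective.comp φ.injective
  let _ : PartialOrder ι := PartialOrder.lift ψ hψ
  have hsurj : ∀ k ≤ 2, ∀ Δ, Γ.IsNest α k Δ → ∃ p, ψ p = Δ := fun k hk Δ hΔ =>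
    ⟨φ.symm ⟨Δ, k, hk, hΔ⟩, congrArg Subtype.val (φ.apply_symm_apply _)⟩
  have : Nonempty ι := by
    obtain ⟨x, hx⟩ := hconn.1
    obtain ⟨Δ, hΔ, -⟩ := hα.exists_isNest_zero hreg hx
    exact (hsurj 0 (by omega) Δ hΔ).nonempty
  have hvtx : ∀ x ∈ V(Γ), ∃ p, Γ.IsNest α 0 (ψ p) ∧ x ∈ V(ψ p) := fun x hx => by
    obtain ⟨Δ, hΔ, hxΔ⟩ := hα.exists_isNest_zero hreg hx
    obtain ⟨p, rfl⟩ := hsurj 0 (by omega) Δ hΔ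
    exact ⟨p, hΔ, hxΔ⟩
  have hedg : ∀ e ∈ E(Γ), ∃ p, Γ.IsNest α 1 (ψ p) ∧ e ∈ E(ψ p) := fun e he => by
    obtain ⟨Δ, hΔ, heΔ⟩ := hα.exists_isNest_one hreg he
    obtain ⟨p, rfl⟩ := hsurj 1 (by omega) Δ hΔ
    exact ⟨p, hΔ, heΔ⟩
  choose! vtx hvtx0 hvtx1 using hvtx
  choose! edg hedg0 hedg1 using hedg
  have hP : IsNestPoset Γ α ψ vtx edg :=
    { le_iff := fun p q => Iff.rfl
      exists_isNest := fun p => (φ p).2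
      exists_eq := hsurj 2 le_rfl
      isNest_vtx := hvtx0
      mem_vtx := hvtx1
      isNest_edg := hedg0
      mem_edg := hedg1 }
  have hS := hP.isSurfacePoset hgood hreg hconn
  have hrank : ∀ p, Γ.IsNest α (colorDim α (ψ p)) (ψ p) := fun p => by
    obtain ⟨k, -, hk⟩ := hP.exists_isNest p
    rwa [hk.2.2.1]
  let K : SkeletalExpansion Γ α 2 (OrderComplex ι) :=
    { t2 := inferInstance
      cw := OrderComplex.cwComplex hS
      finite := OrderComplex.finite_cwComplex hS
      regular := OrderComplex.isRegularCellDecomposition_cwComplex hS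
      nest := (Equiv.sigmaFiberEquiv fun p => colorDim α (ψ p)).trans φ
      isNest_nest := fun d c => by
        obtain ⟨p, rfl⟩ := c
        exact hrank p
      face_iff := fun s t => OrderComplex.face_iff hS s.2 t.2 }
  refine ⟨OrderComplex ι, inferInstance, K, OrderComplex.isClosedSurface hS,
    fun Δ hΔ => hgood.isCircle_of_isNest_two hV hE hΔ,
    fun f => OrderComplex.cellMap_sphere_eq_iUnion hS 2 f, fun e he => ?_⟩
  obtain ⟨Δ, Δ', hne, hΔ⟩ := hgood.exists_isNest_two_iff hreg he
  have hcell : ∀ Θ, Γ.IsNest α 2 Θ → ∃ f : K.Cell 2, K.nestOf f = Θ := fun Θ hΘ => by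
    obtain ⟨p, rfl⟩ := hP.exists_eq Θ hΘ
    exact ⟨⟨p, hΘ.2.2.1⟩, rfl⟩
  have hinj : ∀ f f' : K.Cell 2, K.nestOf f = K.nestOf f' → f = f' := fun f f' hff =>
    Subtype.ext (hψ hff)
  obtain ⟨f, rfl⟩ := hcell Δ ((hΔ Δ).mpr (Or.inl rfl)).1
  obtain ⟨f', rfl⟩ := hcell Δ' ((hΔ Δ').mpr (Or.inr rfl)).1
  have hset : {g : K.Cell 2 | e ∈ E(K.nestOf g)} = {f, f'} := by
    ext g
    have hg : Γ.IsNest α 2 (K.nestOf g) := K.isNest_nest 2 g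
    constructor
    · intro heg
      exact ((hΔ _).mp ⟨hg, heg⟩).imp (hinj g f) (hinj g f')
    · rintro (rfl | rfl)
      · exact ((hΔ _).mpr (Or.inl rfl)).2
      · exact ((hΔ _).mpr (Or.inr rfl)).2
  rw [hset, encard_pair fun hff => hne (congrArg K.nestOf hff)]
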